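/- Let $(x_0,y_0)$ be the lower left corner of a rectangular domain $\Omega$ and let $R=[x_0,x_0+r]\times[y_0,y_0+s]\subset\overline\Omega$ ($r,s>0$) lie on one side of the interface, with $\{x_0\}\times(y_0,y_0+s)\subset\Gamma_1$ and $(x_0,x_0+r)\times\{y_0\}\subset\Gamma_3$. Consider near the corner $$-\nabla\cdot(a\nabla u)=f \text{ in } \operatorname{int}R,\qquad -u_x+\alpha u=g_1 \text{ on }\Gamma_1\cap R,\qquad -u_y=g_3\text{ on }\Gamma_3\cap R,$$ with $a>0$ on $R$. All derivatives below are taken at the corner: $v^{(m,n)}=\partial_x^m\partial_y^n v(x_0,y_0)$, $\alpha^{(n)},g_1^{(n)}$ at $y_0$, $g_3^{(n)}$ at $x_0$. Let $\Lambda_M=\{(m,n)\in\mathbb N_0^2: m+n\le M\}$, and let $h\to0^+$ (continuously, or along any family of mesh sizes tending to $0$). A 4-point scheme consists of functions $C_{k,\ell}(h)$, $k,\ell\in\{0,1\}$, not all tending to zero (that is, $\max_{k,\ell}|C_{k,\ell}(h)|\ge\delta>0$ for all small $h$), and of a right-hand side that is a linear combination, with $h$-dependent weights, of finitely many derivatives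 $f^{(m,n)},g_1^{(n)},g_3^{(n)}$. It is consistent of order $p$ if, for every sufficiently smooth solution $u$ with its data $f,g_1,g_3$, $$\sum_{k,\ell\in\{0,1\}}C_{k,\ell}(h)\,u(x_0+kh,y_0+\ell h)-(\text{right-hand side})=O(h^{p+1}).$$ Construction. Differentiating the equation at the corner expresses every $u^{(m,n)}$ linearly through the $u^{(0,j)}$, $u^{(1,j)}$ and $f^{(i,j)}$. Inserting this in the Taylor polynomial of degree 6 gives $$u(x_0+x,y_0+y)\approx\sum_{n=0}^{6}u^{(0,n)}G^V_{5,0,n}(x,y)+\sum_{n=0}^{5}u^{(1,n)}G^V_{5,1,n}(x,y)+\sum_{(m,n)\in\Lambda_4}f^{(m,n)}Q^V_{5,m,n}(x,y)$$ with polynomials $G^V,Q^V$ determined by the derivatives of $a$ at the corner. Substitute $u^{(1,n)}=\sum_{i\le n}\binom ni\alpha^{(n-i)}u^{(0,i)}-g_1^{(n)}$, and replace successively each $u^{(0,n)}$ with $n$ odd by its expression through $f^{(i,j)}$, $u^{(m,1)}=-g_3^{(m)}$ and $u^{(m,0)}$, $m<n$, obtained by solving the differentiated equation for derivatives in $y$,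 where the $u^{(m,0)}$ are in turn expressed through $f^{(i,j)}$, $g_1^{(j)}$ and the $u^{(0,j)}$, $j<n$. The result is an expansion $$\sum_{n\in\{0,2,4,6\}}u^{(0,n)}E_n+\sum_{(m,n)\in\Lambda_4}f^{(m,n)}F_{m,n}+\sum_{n=0}^5 g_1^{(n)}K^1_n+\sum_{n=0}^5 g_3^{(n)}K^3_n$$ with polynomials $E_n,F_{m,n},K^1_n,K^3_n$ in $(x,y)$ determined by $a$ and $\alpha$. For real numbers $c_{k,\ell,i}$ put $C_{k,\ell}(h)=\sum_{i=0}^6c_{k,\ell,i}h^i$ and consider the linear system $$\sum_{k,\ell\in\{0,1\}}C_{k,\ell}(h)\,E_n(kh,\ell h)=O(h^7),\qquad n=0,2,4,6.\tag{$*$}$$ Theorem. (1) Let $a\in C^6(R)$ and $\alpha\in C^5([y_0,y_0+s])$. Then $(*)$ has a solution with $c_{1,1,0}=1$. For every solution of $(*)$, the stencil coefficients $C_{k,\ell}(h)$ and the right-hand side $$\sum_{(m,n)\in\Lambda_4}f^{(m,n)}C_{f,m,n}+\sum_{n=0}^5g_1^{(n)}C_{g_1,n}+\sum_{n=0}^5g_3^{(n)}C_{g_3,n},$$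 where $C_{f,m,n}$, $C_{g_1,n}$, $C_{g_3,n}$ are $\sum_{k,\ell}C_{k,\ell}(h)P(kh,\ell h)$ with $P=F_{m,n},K^1_n,K^3_n$ respectively, leave a residual $O(h^7)$ for all $u\in C^7(R)$ with $f,g_1,g_3$ of class $C^5$ up to the boundary; if moreover some $c_{k,\ell,0}\ne0$, this is a 4-point scheme (the normalization above holds), consistent of order six. (2) Six is the largest $p$ such that for all $C^\infty$ coefficients $a>0$ and $\alpha$ there is a 4-point scheme consistent of order $p$ for all $C^\infty$ solutions. Moreover, for each constant $a>0$ and each constant $\alpha\ne0$, six is the largest order of a 4-point scheme for that problem. -/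

import Mathlib

open Set Filter Topology Asymptotics

noncomputable section

namespace CornerFD

/-! ### The elliptic problem near the lower left corner

`(x₀, y₀)` is the lower left corner of the domain and `[x₀, x₀ + r] × [y₀, y₀ + s]` is a closed
rectangle at this corner which is not crossed by the interface, so that the data and the solution
are smooth on it.  The side `{x₀} × (y₀, y₀ + s)` lies on `Γ₁` and the side
`(x₀, x₀ + r) × {y₀}` lies on `Γ₃`. -/

/-- The closed rectangle at the corner. -/
def rect (x₀ y₀ r s : ℝ) : Set (ℝ × ℝ) := Icc x₀ (x₀ + r) ×ˢ Icc y₀ (y₀ + s)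

/-- The coefficient `a` of the equation is positive and of class `C^(k+1)`, and the Robin
coefficient `α` on `Γ₁` is of class `C^k`, up to the boundary. -/
structure Coefficients (k : ℕ∞) (x₀ y₀ r s : ℝ) (a : ℝ × ℝ → ℝ) (α : ℝ → ℝ) : Prop where
  contDiffOn_a : ContDiffOn ℝ ((k + 1 : ℕ∞) : WithTop ℕ∞) a (rect x₀ y₀ r s)
  contDiffOn_α : ContDiffOn ℝ (k : WithTop ℕ∞) α (Icc y₀ (y₀ + s))
  a_pos : ∀ z ∈ rect x₀ y₀ r s, 0 < a z

/-- `u` is a solution with data `f`, `g₁`, `g₃`: `u` is of class `C^(k+2)` and the data are of class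
`C^k` up to the boundary, `-∇·(a∇u) = f` in the open rectangle, `∂u/∂n + αu = g₁` on `Γ₁` (where the
outward normal is `(-1, 0)`), and `∂u/∂n = g₃` on `Γ₃` (where the outward normal is `(0, -1)`). -/
structure Solution (k : ℕ∞) (x₀ y₀ r s : ℝ) (a : ℝ × ℝ → ℝ) (α : ℝ → ℝ)
    (u f : ℝ × ℝ → ℝ) (g₁ g₃ : ℝ → ℝ) : Prop where
  contDiffOn_u : ContDiffOn ℝ ((k + 2 : ℕ∞) : WithTop ℕ∞) u (rect x₀ y₀ r s)
  contDiffOn_f : ContDiffOn ℝ (k : WithTop ℕ∞) f (rect x₀ y₀ r s)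
  contDiffOn_g₁ : ContDiffOn ℝ (k : WithTop ℕ∞) g₁ (Icc y₀ (y₀ + s))
  contDiffOn_g₃ : ContDiffOn ℝ (k : WithTop ℕ∞) g₃ (Icc x₀ (x₀ + r))
  pde : ∀ x ∈ Ioo x₀ (x₀ + r), ∀ y ∈ Ioo y₀ (y₀ + s),
    -(deriv (fun t => a (t, y) * deriv (fun t' => u (t', y)) t) x
      + deriv (fun t => a (x, t) * deriv (fun t' => u (x, t')) t) y) = f (x, y)
  robin : ∀ y ∈ Ioo y₀ (y₀ + s),
    -derivWithin (fun t => u (t, y)) (Ici x₀) x₀ + α y * u (x₀, y) = g₁ y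
  neumann : ∀ x ∈ Ioo x₀ (x₀ + r),
    -derivWithin (fun t => u (x, t)) (Ici y₀) y₀ = g₃ x

/-- The one-sided derivative `g⁽ⁿ⁾` of a function of one variable at the left end point `t₀`. -/
def jet₁ (g : ℝ → ℝ) (t₀ : ℝ) (n : ℕ) : ℝ := iteratedDerivWithin n g (Ici t₀) t₀

/-- The partial derivative `v⁽ᵐ'ⁿ⁾ = ∂^(m+n) v / ∂x^m ∂y^n` at the corner `(x₀, y₀)`, taken from
inside the quadrant `x ≥ x₀`, `y ≥ y₀`. -/
def jet₂ (v : ℝ × ℝ → ℝ) (x₀ y₀ : ℝ) (m n : ℕ) : ℝ :=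
  iteratedDerivWithin m (fun x => iteratedDerivWithin n (fun y => v (x, y)) (Ici y₀) y₀)
    (Ici x₀) x₀

/-- The index set `Λ_M` of all `(m, n)` with `m + n ≤ M`. -/
def Lam (M : ℕ) : Finset (ℕ × ℕ) :=
  (Finset.range (M + 1) ×ˢ Finset.range (M + 1)).filter (fun p => p.1 + p.2 ≤ M)

/-! ### Four-point schemes -/

/-- A 4-point finite difference scheme at the corner: coefficients `C k ℓ h` of the values at
`(x₀ + kh, y₀ + ℓh)`, `k, ℓ ∈ {0, 1}`, and a right-hand side that is a linear combination of
derivatives of `f`, `g₁`, `g₃` at the corner up to some orders `Mf`, `M₁`, `M₃`. -/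
structure FourPointScheme where
  C : Fin 2 → Fin 2 → ℝ → ℝ
  Mf : ℕ
  Cf : ℕ → ℕ → ℝ → ℝ
  M₁ : ℕ
  Cg₁ : ℕ → ℝ → ℝ
  M₃ : ℕ
  Cg₃ : ℕ → ℝ → ℝ

namespace FourPointScheme

/-- The left-hand side of the scheme, applied to the exact solution. -/
def lhs (S : FourPointScheme) (x₀ y₀ : ℝ) (u : ℝ × ℝ → ℝ) (h : ℝ) : ℝ :=
  ∑ k : Fin 2, ∑ ℓ : Fin 2, S.C k ℓ h * u (x₀ + (k : ℕ) * h, y₀ + (ℓ : ℕ) * h)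

/-- The right-hand side of the scheme. -/
def rhs (S : FourPointScheme) (x₀ y₀ : ℝ) (f : ℝ × ℝ → ℝ) (g₁ g₃ : ℝ → ℝ) (h : ℝ) : ℝ :=
  ∑ p ∈ Lam S.Mf, jet₂ f x₀ y₀ p.1 p.2 * S.Cf p.1 p.2 h
    + ∑ n ∈ Finset.range (S.M₁ + 1), jet₁ g₁ y₀ n * S.Cg₁ n h
    + ∑ n ∈ Finset.range (S.M₃ + 1), jet₁ g₃ x₀ n * S.Cg₃ n h

/-- The scheme is normalized: the stencil coefficients do not all become small as `h → 0`
along `l`. -/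
def Nondegenerate (S : FourPointScheme) (l : Filter ℝ) : Prop :=
  ∃ δ > 0, ∀ᶠ h in l, ∃ k ℓ, δ ≤ |S.C k ℓ h|

/-- Consistency of order `p`: for every solution of class `C^(k+2)` with data of class `C^k`, the
residual is `O(h^(p+1))`.  The exponent is `p + 1`, since the stencil coefficients are of order `1`
and the boundary data, a first derivative of `u`, enter with weights of order `h`. -/
def Consistent (S : FourPointScheme) (k : ℕ∞) (l : Filter ℝ) (x₀ y₀ r s : ℝ) (a : ℝ × ℝ → ℝ)
    (α : ℝ → ℝ) (p : ℕ) : Prop :=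
  ∀ (u f : ℝ × ℝ → ℝ) (g₁ g₃ : ℝ → ℝ), Solution k x₀ y₀ r s a α u f g₁ g₃ →
    (fun h => S.lhs x₀ y₀ u h - S.rhs x₀ y₀ f g₁ g₃ h) =O[l] (fun h => h ^ (p + 1))

end FourPointScheme

/-- `p` is an accuracy order which some 4-point scheme for the problem with coefficients `a`, `α`
attains for all smooth (`C^∞`) solutions. -/
def AttainsOrder (l : Filter ℝ) (x₀ y₀ r s : ℝ) (a : ℝ × ℝ → ℝ) (α : ℝ → ℝ) (p : ℕ) : Prop :=
  ∃ S : FourPointScheme, S.Nondegenerate l ∧ S.Consistent ⊤ l x₀ y₀ r s a α p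

/-! ### The polynomials `G^V`, `Q^V` and their analogues in the other direction

Throughout, `A i j` stands for the derivative `a⁽ⁱ'ʲ⁾` at the corner. -/

/-- Differentiating `a (u_xx + u_yy) + a_x u_x + a_y u_y = -f` and solving for the highest
derivative in `x` determines all `u⁽ᵐ'ⁿ⁾` from `u⁽⁰'ⁿ⁾ = p n`, `u⁽¹'ⁿ⁾ = q n` and
`f⁽ᵐ'ⁿ⁾ = F m n`. -/
def vJet (A : ℕ → ℕ → ℝ) (p q : ℕ → ℝ) (F : ℕ → ℕ → ℝ) : ℕ → ℕ → ℝ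
  | 0, n => p n
  | 1, n => q n
  | m + 2, n =>
    -vJet A p q F m (n + 2)
      - (F m n
        + ∑ i : Fin (m + 1), ∑ j : Fin (n + 1), (m.choose i : ℝ) * (n.choose j : ℝ) *
          ((if _h : (i : ℕ) = 0 ∧ (j : ℕ) = 0 then 0
            else A i j * (vJet A p q F (m - i + 2) (n - j) + vJet A p q F (m - i) (n - j + 2)))
            + A (i + 1) j * vJet A p q F (m - i + 1) (n - j)
            + A i (j + 1) * vJet A p q F (m - i) (n - j + 1))) / A 0 0
termination_by m n => (m, n)
decreasing_by
  all_goals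
    try have hi := i.isLt
    try have hj := j.isLt
    simp only [Prod.lex_def]
    omega

/-- The same with the roles of `x` and `y` interchanged: all `u⁽ᵐ'ⁿ⁾` from `u⁽ᵐ'⁰⁾ = p m`,
`u⁽ᵐ'¹⁾ = q m` and `f⁽ᵐ'ⁿ⁾ = F m n`. -/
def hJet (A : ℕ → ℕ → ℝ) (p q : ℕ → ℝ) (F : ℕ → ℕ → ℝ) (m n : ℕ) : ℝ :=
  vJet (fun i j => A j i) p q (fun i j => F j i) n m

/-- The polynomial of degree `≤ d` with derivatives `J m n` at the origin. -/
def taylorPoly (d : ℕ) (J : ℕ → ℕ → ℝ) (x y : ℝ) : ℝ :=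
  ∑ p ∈ Lam d, J p.1 p.2 * x ^ p.1 * y ^ p.2 / ((p.1.factorial : ℝ) * (p.2.factorial : ℝ))

/-- `G^V_{M,m,n}` for `m ∈ {0, 1}`: the weight of `u⁽ᵐ'ⁿ⁾` in the expansion of `u` to degree
`M + 1`. -/
def GV (A : ℕ → ℕ → ℝ) (M m n : ℕ) : ℝ → ℝ → ℝ :=
  taylorPoly (M + 1) (vJet A (fun j => if m = 0 ∧ j = n then 1 else 0)
    (fun j => if m = 1 ∧ j = n then 1 else 0) (fun _ _ => 0))

/-- `Q^V_{M,m,n}`: the weight of `f⁽ᵐ'ⁿ⁾` in the expansion of `u` to degree `M + 1`. -/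
def QV (A : ℕ → ℕ → ℝ) (M m n : ℕ) : ℝ → ℝ → ℝ :=
  taylorPoly (M + 1) (vJet A (fun _ => 0) (fun _ => 0) (fun i j => if i = m ∧ j = n then 1 else 0))

/-! ### The corner construction

Here `al n = α⁽ⁿ⁾`, `F m n = f⁽ᵐ'ⁿ⁾`, `G₁ n = g₁⁽ⁿ⁾`, `G₃ n = g₃⁽ⁿ⁾`. -/

/-- The Robin condition `u_x = αu - g₁` on `Γ₁`: the derivative `u⁽¹'ⁿ⁾` in terms of the
`u⁽⁰'ⁱ⁾ = t i`. -/
def robinJet (al t G₁ : ℕ → ℝ) (n : ℕ) : ℝ :=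
  ∑ i ∈ Finset.range (n + 1), (n.choose i : ℝ) * al (n - i) * t i - G₁ n

/-- The derivatives `u⁽⁰'ⁿ⁾` in terms of those of even order, `e n`.  For odd `n`, the expansion in
the other direction together with the Neumann condition `u⁽ᵐ'¹⁾ = -g₃⁽ᵐ⁾` on `Γ₃` gives `u⁽⁰'ⁿ⁾`
from the `u⁽ᵐ'⁰⁾` with `m < n`, which depend only on the `u⁽⁰'ʲ⁾` with `j < n`. -/
def traceJet (A : ℕ → ℕ → ℝ) (al e : ℕ → ℝ) (F : ℕ → ℕ → ℝ) (G₁ G₃ : ℕ → ℝ) (n : ℕ) : ℝ :=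
  if Even n then e n
  else
    let t : ℕ → ℝ := fun j => if _h : j < n then traceJet A al e F G₁ G₃ j else 0
    hJet A (fun m => if m < n then vJet A t (robinJet al t G₁) F m 0 else 0) (fun m => -G₃ m) F 0 n
termination_by n

/-- The expansion of `u` at the corner, with `M = 5`, after both boundary conditions have been
inserted. -/
def cornerExpansion (A : ℕ → ℕ → ℝ) (al e : ℕ → ℝ) (F : ℕ → ℕ → ℝ) (G₁ G₃ : ℕ → ℝ)
    (x y : ℝ) : ℝ :=
  ∑ n ∈ Finset.range 7, traceJet A al e F G₁ G₃ n * GV A 5 0 n x y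
    + ∑ n ∈ Finset.range 6, robinJet al (traceJet A al e F G₁ G₃) G₁ n * GV A 5 1 n x y
    + ∑ p ∈ Lam 4, F p.1 p.2 * QV A 5 p.1 p.2 x y

/-- The weight of `u⁽⁰'ⁿ⁾`, `n` even, in the corner expansion. -/
def cornerE (A : ℕ → ℕ → ℝ) (al : ℕ → ℝ) (n : ℕ) : ℝ → ℝ → ℝ :=
  cornerExpansion A al (fun j => if j = n then 1 else 0) (fun _ _ => 0) (fun _ => 0) (fun _ => 0)

/-- The weight of `f⁽ᵐ'ⁿ⁾` in the corner expansion. -/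
def cornerF (A : ℕ → ℕ → ℝ) (al : ℕ → ℝ) (m n : ℕ) : ℝ → ℝ → ℝ :=
  cornerExpansion A al (fun _ => 0) (fun i j => if i = m ∧ j = n then 1 else 0) (fun _ => 0)
    (fun _ => 0)

/-- The weight of `g₁⁽ⁿ⁾` in the corner expansion. -/
def cornerG₁ (A : ℕ → ℕ → ℝ) (al : ℕ → ℝ) (n : ℕ) : ℝ → ℝ → ℝ :=
  cornerExpansion A al (fun _ => 0) (fun _ _ => 0) (fun j => if j = n then 1 else 0) (fun _ => 0)

/-- The weight of `g₃⁽ⁿ⁾` in the corner expansion. -/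
def cornerG₃ (A : ℕ → ℕ → ℝ) (al : ℕ → ℝ) (n : ℕ) : ℝ → ℝ → ℝ :=
  cornerExpansion A al (fun _ => 0) (fun _ _ => 0) (fun _ => 0) (fun j => if j = n then 1 else 0)

/-- `C_{k,ℓ}(h) = ∑_{i=0}^6 c_{k,ℓ,i} h^i`. -/
def polyC (c : Fin 2 → Fin 2 → Fin 7 → ℝ) (k ℓ : Fin 2) (h : ℝ) : ℝ :=
  ∑ i : Fin 7, c k ℓ i * h ^ (i : ℕ)

/-- `∑_{k,ℓ} C_{k,ℓ}(h) E(kh, ℓh)`. -/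
def stencilSum (c : Fin 2 → Fin 2 → Fin 7 → ℝ) (E : ℝ → ℝ → ℝ) (h : ℝ) : ℝ :=
  ∑ k : Fin 2, ∑ ℓ : Fin 2, polyC c k ℓ h * E ((k : ℕ) * h) ((ℓ : ℕ) * h)

/-- The linear system for the `c_{k,ℓ,i}`: the stencil annihilates, up to `O(h^7)`, the weights of
the derivatives `u⁽⁰'⁰⁾, u⁽⁰'²⁾, u⁽⁰'⁴⁾, u⁽⁰'⁶⁾` left free by the equation and the boundary
conditions. -/
def SolvesSystem (A : ℕ → ℕ → ℝ) (al : ℕ → ℝ) (c : Fin 2 → Fin 2 → Fin 7 → ℝ) : Prop :=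
  ∀ n ∈ ({0, 2, 4, 6} : Set ℕ), stencilSum c (cornerE A al n) =O[𝓝 0] (fun h => h ^ 7)

/-- The 4-point scheme with stencil coefficients `C_{k,ℓ}(h)`, whose right-hand side is
`∑_{Λ₄} f⁽ᵐ'ⁿ⁾ C_{f,m,n} + ∑_{n≤5} g₁⁽ⁿ⁾ C_{g₁,n} + ∑_{n≤5} g₃⁽ⁿ⁾ C_{g₃,n}`. -/
def cornerScheme (A : ℕ → ℕ → ℝ) (al : ℕ → ℝ) (c : Fin 2 → Fin 2 → Fin 7 → ℝ) :
    FourPointScheme where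
  C := polyC c
  Mf := 4
  Cf := fun m n => stencilSum c (cornerF A al m n)
  M₁ := 5
  Cg₁ := fun n => stencilSum c (cornerG₁ A al n)
  M₃ := 5
  Cg₃ := fun n => stencilSum c (cornerG₃ A al n)

end CornerFD

end

/-!
Order six is attained because the differentiated equation and boundary conditions determine the
whole jet of a solution at the corner linearly from the traces `u⁽⁰'ⁿ⁾` of even order and the jets
of the data. The corner expansion is therefore the Taylor polynomial of degree 6 of `u`, and a
stencil that annihilates `E₀`, `E₂`, `E₄`, `E₆` up to `O(h⁷)` leaves only the Taylor remainder.
Moreover `E_n(kh, ℓh) = hⁿ (Re (ℓ + ik)ⁿ / n! + O(h))`: with `C₁₁` prescribed, the conditions for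
`n = 0, 2, 4` are a linear system over `ℝ[h]` whose determinant does not vanish at `h = 0`, and the
condition for `n = 6`, which concerns only `h = 0`, follows from that for `n = 2` because
`(ℓ + ik)⁶` and `(ℓ + ik)²` have proportional real parts on the four grid points.

Order seven is impossible for constant `a` and `α ≠ 0` because the real parts of
`zⁿ / n! - iα zⁿ⁺¹ / (n + 1)!`, `n = 0, 2, 4, 6`, where `z` is the coordinate `y + ix` centred at
the corner, solve the homogeneous problem. Testing a scheme with them gives three independent
relations between the `C_{k,ℓ}(h)` in the limit `h → 0`, and the next order of the proportionality
between `n = 2` and `n = 6`, which has the factor `α`, gives a fourth. Hence all `C_{k,ℓ}(h)` tend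
to zero.
-/

namespace CornerFD

section JetRecursion

/-! ### Formal jets -/

/-- The contribution of `∂ₓⁱ∂_yʲ a` and of its first derivatives to `∂ₓᵐ∂_yⁿ ∇·(a∇u)`, where `A`
and `J` are the jets of `a` and `u`. -/
def jetTerm (A J : ℕ → ℕ → ℝ) (m n i j : ℕ) : ℝ :=
  A i j * (J (m - i + 2) (n - j) + J (m - i) (n - j + 2))
    + A (i + 1) j * J (m - i + 1) (n - j) + A i (j + 1) * J (m - i) (n - j + 1)

/-- The jet of `∇·(a∇u) = a (u_xx + u_yy) + a_x u_x + a_y u_y` in terms of the jets `A` of `a` and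
`J` of `u`, by the Leibniz rule. -/
def divergenceJet (A J : ℕ → ℕ → ℝ) (m n : ℕ) : ℝ :=
  ∑ i ∈ Finset.range (m + 1), ∑ j ∈ Finset.range (n + 1),
    (m.choose i : ℝ) * (n.choose j : ℝ) * jetTerm A J m n i j

/-- The part of `divergenceJet A J m n` that involves the derivatives of `u` of order less than
`m + n + 2` only. -/
def lowerJet (A J : ℕ → ℕ → ℝ) (m n : ℕ) : ℝ :=
  ∑ i ∈ Finset.range (m + 1), ∑ j ∈ Finset.range (n + 1), (m.choose i : ℝ) * (n.choose j : ℝ) *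
    ((if i = 0 ∧ j = 0 then 0 else A i j * (J (m - i + 2) (n - j) + J (m - i) (n - j + 2)))
      + A (i + 1) j * J (m - i + 1) (n - j) + A i (j + 1) * J (m - i) (n - j + 1))

/-- The value of `u⁽ᵐ⁺²'ⁿ⁾` obtained by solving the differentiated equation for it. -/
noncomputable def solveX (A F J : ℕ → ℕ → ℝ) (m n : ℕ) : ℝ :=
  -J m (n + 2) - (F m n + lowerJet A J m n) / A 0 0

variable {A F F' J J' : ℕ → ℕ → ℝ} {al p p' q q' t t' e e' G G' G₁ G₁' G₃ G₃' : ℕ → ℝ} {m n N : ℕ}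

lemma divergenceJet_swap (A J : ℕ → ℕ → ℝ) (m n : ℕ) :
    divergenceJet (fun i j => A j i) (fun i j => J j i) n m = divergenceJet A J m n := by
  unfold divergenceJet jetTerm
  rw [Finset.sum_comm]
  refine Finset.sum_congr rfl fun i _ => Finset.sum_congr rfl fun j _ => ?_
  ring

lemma divergenceJet_eq_add_lowerJet (A J : ℕ → ℕ → ℝ) (m n : ℕ) :
    divergenceJet A J m n = A 0 0 * (J (m + 2) n + J m (n + 2)) + lowerJet A J m n := by
  have leading : A 0 0 * (J (m + 2) n + J m (n + 2)) =
      ∑ i ∈ Finset.range (m + 1), ∑ j ∈ Finset.range (n + 1),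
        if i = 0 ∧ j = 0 then A 0 0 * (J (m + 2) n + J m (n + 2)) else 0 := by
    rw [Finset.sum_eq_single 0, Finset.sum_eq_single 0] <;> simp +contextual
  rw [leading, divergenceJet, lowerJet, ← Finset.sum_add_distrib]
  refine Finset.sum_congr rfl fun i _ => ?_
  rw [← Finset.sum_add_distrib]
  refine Finset.sum_congr rfl fun j _ => ?_
  unfold jetTerm
  split_ifs with h
  · obtain ⟨rfl, rfl⟩ := h
    simp only [Nat.choose_zero_right, Nat.sub_zero, Nat.cast_one]
    ring
  · ring

lemma solveX_of_divergenceJet (hA : A 0 0 ≠ 0) (h : divergenceJet A J m n = -F m n) :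
    J (m + 2) n = solveX A F J m n := by
  rw [divergenceJet_eq_add_lowerJet] at h
  unfold solveX
  field_simp
  linarith

lemma lowerJet_congr (h : ∀ i j, i + j < m + n + 2 → J i j = J' i j) :
    lowerJet A J m n = lowerJet A J' m n := by
  unfold lowerJet
  refine Finset.sum_congr rfl fun i hi => Finset.sum_congr rfl fun j hj => ?_
  have hi := Finset.mem_range.1 hi
  have hj := Finset.mem_range.1 hj
  rw [h (m - i + 1) (n - j) (by omega), h (m - i) (n - j + 1) (by omega)]
  split_ifs with hij
  · rfl
  · rw [h (m - i + 2) (n - j) (by omega), h (m - i) (n - j + 2) (by omega)]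

lemma lowerJet_lincomb (A J J' : ℕ → ℕ → ℝ) (b c : ℝ) (m n : ℕ) :
    lowerJet A (b • J + c • J') m n = b * lowerJet A J m n + c * lowerJet A J' m n := by
  simp only [lowerJet, Finset.mul_sum, ← Finset.sum_add_distrib]
  refine Finset.sum_congr rfl fun i _ => Finset.sum_congr rfl fun j _ => ?_
  simp only [Pi.add_apply, Pi.smul_apply, smul_eq_mul]
  split_ifs <;> ring

lemma solveX_lincomb (A F F' J J' : ℕ → ℕ → ℝ) (b c : ℝ) (m n : ℕ) :
    solveX A (b • F + c • F') (b • J + c • J') m n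
      = b * solveX A F J m n + c * solveX A F' J' m n := by
  simp only [solveX, lowerJet_lincomb, Pi.add_apply, Pi.smul_apply, smul_eq_mul]
  ring

lemma solveX_congr (hF : F m n = F' m n) (hJ : ∀ i j, i + j < m + n + 2 → J i j = J' i j)
    (hJ' : J m (n + 2) = J' m (n + 2)) : solveX A F J m n = solveX A F' J' m n := by
  rw [solveX, solveX, hF, hJ', lowerJet_congr hJ]

lemma vJet_zero (A : ℕ → ℕ → ℝ) (p q : ℕ → ℝ) (F : ℕ → ℕ → ℝ) (n : ℕ) :
    vJet A p q F 0 n = p n := by rw [vJet]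

lemma vJet_one (A : ℕ → ℕ → ℝ) (p q : ℕ → ℝ) (F : ℕ → ℕ → ℝ) (n : ℕ) :
    vJet A p q F 1 n = q n := by rw [vJet]

lemma vJet_add_two (A : ℕ → ℕ → ℝ) (p q : ℕ → ℝ) (F : ℕ → ℕ → ℝ) (m n : ℕ) :
    vJet A p q F (m + 2) n = solveX A F (vJet A p q F) m n := by
  rw [vJet, solveX, lowerJet]
  simp only [Finset.sum_range, dite_eq_ite]

/-- The value `p (m + n)` influences `vJet A p q F m n` only for even `m`, since the recursion
lowers `m` in steps of two as long as it stays at order `m + n`. -/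
lemma vJet_eq_of_solveX (hJ : ∀ i j, i + j + 2 ≤ m + n → J (i + 2) j = solveX A F J i j)
    (hp : ∀ j < m + n, p j = J 0 j) (hp' : Even m → p (m + n) = J 0 (m + n))
    (hq : ∀ j, j + 1 ≤ m + n → q j = J 1 j) : vJet A p q F m n = J m n := by
  induction hN : m + n using Nat.strong_induction_on generalizing m n with
  | _ N IHN =>
  induction m using Nat.strong_induction_on generalizing n with
  | _ m IHm =>
  match m, IHm, hJ, hp, hp', hq, hN with
  | 0, _, _, _, hp', _, _ => simpa [vJet_zero] using hp'
  | 1, _, _, _, _, hq, _ => exact (vJet_one ..).trans (hq n (by omega))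
  | m + 2, IHm, hJ, hp, hp', hq, hN =>
    have order_lt (i j : ℕ) (hij : i + j < N) : vJet A p q F i j = J i j :=
      IHN (i + j) hij (fun k l h => hJ k l (by omega)) (fun k h => hp k (by omega))
        (fun _ => hp _ (by omega)) (fun k h => hq k (by omega)) rfl
    have order_eq : vJet A p q F m (n + 2) = J m (n + 2) := by
      refine IHm m (by omega) (fun k l h => hJ k l (by omega)) (fun k h => hp k (by omega))
        (fun h => ?_) (fun k h => hq k (by omega)) (by omega)
      rw [show m + (n + 2) = m + 2 + n by omega]
      exact hp' (by simpa [Nat.even_add] using h)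
    rw [vJet_add_two, hJ m n (by omega)]
    exact solveX_congr rfl (fun i j hij => order_lt i j (by omega)) order_eq

lemma vJet_congr (hF : ∀ i j, i + j + 2 ≤ m + n → F i j = F' i j)
    (hp : ∀ j < m + n, p j = p' j) (hp' : Even m → p (m + n) = p' (m + n))
    (hq : ∀ j, j + 1 ≤ m + n → q j = q' j) : vJet A p q F m n = vJet A p' q' F' m n :=
  vJet_eq_of_solveX
    (fun i j h => (vJet_add_two ..).trans (solveX_congr (hF i j h).symm (fun _ _ _ => rfl) rfl))
    (by simpa only [vJet_zero] using hp) (by simpa only [vJet_zero] using hp')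
    (by simpa only [vJet_one] using hq)

lemma vJet_lincomb (A : ℕ → ℕ → ℝ) (b c : ℝ) (p p' q q' : ℕ → ℝ) (F F' : ℕ → ℕ → ℝ) :
    vJet A (b • p + c • p') (b • q + c • q') (b • F + c • F')
      = b • vJet A p q F + c • vJet A p' q' F' := by
  ext m n
  refine vJet_eq_of_solveX (fun i j _ => ?_) ?_ ?_ ?_
  · simp only [solveX_lincomb, Pi.add_apply, Pi.smul_apply, vJet_add_two, smul_eq_mul]
  all_goals simp [vJet_zero, vJet_one]

lemma hJet_lincomb (A : ℕ → ℕ → ℝ) (b c : ℝ) (p p' q q' : ℕ → ℝ) (F F' : ℕ → ℕ → ℝ) (m n : ℕ) :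
    hJet A (b • p + c • p') (b • q + c • q') (b • F + c • F') m n
      = b * hJet A p q F m n + c * hJet A p' q' F' m n :=
  congrFun₂ (vJet_lincomb ..) n m

lemma robinJet_lincomb (al : ℕ → ℝ) (b c : ℝ) (t t' G G' : ℕ → ℝ) (n : ℕ) :
    robinJet al (b • t + c • t') (b • G + c • G') n
      = b * robinJet al t G n + c * robinJet al t' G' n := by
  simp only [robinJet, Pi.add_apply, Pi.smul_apply, smul_eq_mul, mul_add, Finset.sum_add_distrib,
    mul_left_comm _ b, mul_left_comm _ c, ← Finset.mul_sum]
  ring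

lemma robinJet_congr (ht : ∀ i ≤ n, t i = t' i) (hG : G n = G' n) :
    robinJet al t G n = robinJet al t' G' n := by
  unfold robinJet
  rw [hG, Finset.sum_congr rfl fun i hi => by rw [ht i (Finset.mem_range_succ_iff.1 hi)]]

/-! ### The corner construction -/

/-- The jet determined by the even derivatives `u⁽⁰'ⁿ⁾ = e n` and the jets of the data; the
corner expansion is its Taylor polynomial. -/
noncomputable def cornerJet (A : ℕ → ℕ → ℝ) (al e : ℕ → ℝ) (F : ℕ → ℕ → ℝ) (G₁ G₃ : ℕ → ℝ) :
    ℕ → ℕ → ℝ :=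
  vJet A (traceJet A al e F G₁ G₃) (robinJet al (traceJet A al e F G₁ G₃) G₁) F

/-- The relations that determine the corner jet from `e` and the data, up to the order `N`. -/
structure IsCornerJet (N : ℕ) (A : ℕ → ℕ → ℝ) (al e : ℕ → ℝ) (F : ℕ → ℕ → ℝ) (G₁ G₃ : ℕ → ℝ)
    (J : ℕ → ℕ → ℝ) : Prop where
  recursion : ∀ m n, m + n + 2 ≤ N → J (m + 2) n = solveX A F J m n
  robin : ∀ n, n + 1 ≤ N → J 1 n = robinJet al (J 0) G₁ n
  even_trace : ∀ n ≤ N, Even n → J 0 n = e n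
  odd_trace : ∀ n ≤ N, ¬Even n → J 0 n = hJet A (fun m => J m 0) (fun m => -G₃ m) F 0 n

lemma traceJet_of_not_even (hn : ¬Even n) : traceJet A al e F G₁ G₃ n
    = hJet A (fun m => cornerJet A al e F G₁ G₃ m 0) (fun m => -G₃ m) F 0 n := by
  rw [traceJet, if_neg hn]
  refine vJet_congr (fun _ _ _ => rfl) (fun m hm => ?_) (fun h => absurd h hn) fun _ _ => rfl
  rw [add_zero] at hm
  rw [if_pos hm]
  have trace (j : ℕ) (hj : j < n) : (if _h : j < n then traceJet A al e F G₁ G₃ j else 0)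
      = traceJet A al e F G₁ G₃ j := dif_pos hj
  exact vJet_congr (fun _ _ _ => rfl) (fun j hj => trace j (by omega))
    (fun _ => trace _ (by omega)) fun j hj => robinJet_congr (fun i hi => trace i (by omega)) rfl

lemma isCornerJet_cornerJet (N : ℕ) (A : ℕ → ℕ → ℝ) (al e : ℕ → ℝ) (F : ℕ → ℕ → ℝ)
    (G₁ G₃ : ℕ → ℝ) : IsCornerJet N A al e F G₁ G₃ (cornerJet A al e F G₁ G₃) where
  recursion _ _ _ := vJet_add_two ..
  robin _ _ := (vJet_one ..).trans <| by simp only [robinJet, cornerJet, vJet_zero]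
  even_trace _ _ hn := by rw [cornerJet, vJet_zero, traceJet, if_pos hn]
  odd_trace _ _ hn := (vJet_zero ..).trans (traceJet_of_not_even hn)

lemma IsCornerJet.eq (h : IsCornerJet N A al e F G₁ G₃ J) (h' : IsCornerJet N A al e F G₁ G₃ J')
    (hmn : m + n ≤ N) : J m n = J' m n := by
  have eq_vJet {K : ℕ → ℕ → ℝ} (hK : IsCornerJet N A al e F G₁ G₃ K) {m n : ℕ} (h : m + n ≤ N) :
      K m n = vJet A (K 0) (robinJet al (K 0) G₁) F m n :=
    (vJet_eq_of_solveX (fun i j hij => hK.recursion i j (by omega)) (fun _ _ => rfl)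
      (fun _ => rfl) fun j hj => (hK.robin j (by omega)).symm).symm
  have ext_of_trace {m n : ℕ} (hmn : m + n ≤ N) (ht : ∀ j ≤ m + n, J 0 j = J' 0 j) :
      J m n = J' m n := by
    rw [eq_vJet h hmn, eq_vJet h' hmn]
    exact vJet_congr (fun _ _ _ => rfl) (fun j hj => ht j hj.le) (fun _ => ht _ le_rfl)
      fun j hj => robinJet_congr (fun i hi => ht i (by omega)) rfl
  have trace (n : ℕ) (hn : n ≤ N) : J 0 n = J' 0 n := by
    induction n using Nat.strong_induction_on with
    | _ n IH =>
    by_cases hev : Even n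
    · rw [h.even_trace n hn hev, h'.even_trace n hn hev]
    · rw [h.odd_trace n hn hev, h'.odd_trace n hn hev]
      refine vJet_congr (fun _ _ _ => rfl) (fun m hm => ?_) (fun h => absurd h hev) fun _ _ => rfl
      exact ext_of_trace (by omega) fun j hj => IH j (by omega) (by omega)
  exact ext_of_trace hmn fun j hj => trace j (by omega)

lemma IsCornerJet.lincomb (b c : ℝ) (h : IsCornerJet N A al e F G₁ G₃ J)
    (h' : IsCornerJet N A al e' F' G₁' G₃' J') :
    IsCornerJet N A al (b • e + c • e') (b • F + c • F') (b • G₁ + c • G₁') (b • G₃ + c • G₃')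
      (b • J + c • J') where
  recursion m n hmn := by
    simp only [solveX_lincomb, Pi.add_apply, Pi.smul_apply, smul_eq_mul, h.recursion m n hmn,
      h'.recursion m n hmn]
  robin n hn := by
    have trace : (b • J + c • J') 0 = b • J 0 + c • J' 0 := rfl
    simp only [trace, robinJet_lincomb, Pi.add_apply, Pi.smul_apply, smul_eq_mul, h.robin n hn,
      h'.robin n hn]
  even_trace n hn hev := by
    simp only [Pi.add_apply, Pi.smul_apply, h.even_trace n hn hev, h'.even_trace n hn hev]
  odd_trace n hn hodd := by
    have side : (fun m => -(b • G₃ + c • G₃') m) = b • (fun m => -G₃ m) + c • fun m => -G₃' m := by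
      ext m
      simp only [Pi.add_apply, Pi.smul_apply, smul_eq_mul]
      ring
    rw [side]
    change b * J 0 n + c * J' 0 n = _
    rw [h.odd_trace n hn hodd, h'.odd_trace n hn hodd]
    exact (hJet_lincomb ..).symm

lemma cornerJet_lincomb (A : ℕ → ℕ → ℝ) (al : ℕ → ℝ) (b c : ℝ) (e e' : ℕ → ℝ) (F F' : ℕ → ℕ → ℝ)
    (G₁ G₁' G₃ G₃' : ℕ → ℝ) :
    cornerJet A al (b • e + c • e') (b • F + c • F') (b • G₁ + c • G₁') (b • G₃ + c • G₃')
      = b • cornerJet A al e F G₁ G₃ + c • cornerJet A al e' F' G₁' G₃' := by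
  ext m n
  exact (isCornerJet_cornerJet (m + n) ..).eq
    ((isCornerJet_cornerJet ..).lincomb b c (isCornerJet_cornerJet ..)) le_rfl

/-! ### The corner expansion of a formal solution -/

/-- The corner jet as a linear function of `(e, F, G₁, G₃)`. -/
noncomputable def cornerJetLinear (A : ℕ → ℕ → ℝ) (al : ℕ → ℝ) :
    (ℕ → ℝ) × (ℕ → ℕ → ℝ) × (ℕ → ℝ) × (ℕ → ℝ) →ₗ[ℝ] ℕ → ℕ → ℝ where
  toFun D := cornerJet A al D.1 D.2.1 D.2.2.1 D.2.2.2
  map_add' D D' := by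
    simpa only [one_smul, Prod.fst_add, Prod.snd_add] using
      cornerJet_lincomb A al 1 1 D.1 D'.1 D.2.1 D'.2.1
      D.2.2.1 D'.2.2.1 D.2.2.2 D'.2.2.2
  map_smul' b D := by
    simpa only [zero_smul, add_zero, Prod.smul_fst, Prod.smul_snd, RingHom.id_apply] using
      cornerJet_lincomb A al b 0 D.1 D.1 D.2.1 D.2.1
      D.2.2.1 D.2.2.1 D.2.2.2 D.2.2.2

/-- `vJet` as a linear function of `(p, q, F)`. -/
noncomputable def vJetLinear (A : ℕ → ℕ → ℝ) :
    (ℕ → ℝ) × (ℕ → ℝ) × (ℕ → ℕ → ℝ) →ₗ[ℝ] ℕ → ℕ → ℝ where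
  toFun D := vJet A D.1 D.2.1 D.2.2
  map_add' D D' := by
    simpa only [one_smul, Prod.fst_add, Prod.snd_add] using
      vJet_lincomb A 1 1 D.1 D'.1 D.2.1 D'.2.1 D.2.2 D'.2.2
  map_smul' b D := by
    simpa only [zero_smul, add_zero, Prod.smul_fst, Prod.smul_snd, RingHom.id_apply] using
      vJet_lincomb A b 0 D.1 D.1 D.2.1 D.2.1 D.2.2 D.2.2

/-- The Taylor polynomial as a linear function of the jet. -/
noncomputable def taylorLinear (d : ℕ) (x y : ℝ) : (ℕ → ℕ → ℝ) →ₗ[ℝ] ℝ where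
  toFun J := taylorPoly d J x y
  map_add' J J' := by
    simp only [taylorPoly, Pi.add_apply, add_mul, add_div, Finset.sum_add_distrib]
  map_smul' b J := by
    simp only [taylorPoly, Pi.smul_apply, smul_eq_mul, mul_assoc, mul_div_assoc, Finset.mul_sum,
      RingHom.id_apply]

lemma mem_Lam {M : ℕ} {p : ℕ × ℕ} : p ∈ Lam M ↔ p.1 + p.2 ≤ M := by
  simp only [Lam, Finset.mem_filter, Finset.mem_product, Finset.mem_range]
  omega

lemma taylorPoly_congr {d : ℕ} (h : ∀ m n, m + n ≤ d → J m n = J' m n) (x y : ℝ) :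
    taylorPoly d J x y = taylorPoly d J' x y :=
  Finset.sum_congr rfl fun p hp => by rw [h p.1 p.2 (mem_Lam.1 hp)]

lemma single_eq_ite (n : ℕ) : (Pi.single n 1 : ℕ → ℝ) = fun j => if j = n then 1 else 0 :=
  funext fun j => Pi.single_apply n 1 j

lemma single_single_eq_ite (m n : ℕ) : (Pi.single m (Pi.single n 1) : ℕ → ℕ → ℝ)
    = fun i j => if i = m ∧ j = n then 1 else 0 := by
  ext i j
  by_cases hi : i = m <;> simp [hi, Pi.single_apply]

lemma sum_smul_single_apply (s : Finset ℕ) (c : ℕ → ℝ) (j : ℕ) :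
    (∑ n ∈ s, c n • (Pi.single n 1 : ℕ → ℝ)) j = if j ∈ s then c j else 0 := by
  simp [Finset.sum_apply, Pi.single_apply]

lemma sum_smul_single_single_apply (s : Finset (ℕ × ℕ)) (c : ℕ → ℕ → ℝ) (i j : ℕ) :
    (∑ p ∈ s, c p.1 p.2 • (Pi.single p.1 (Pi.single p.2 1) : ℕ → ℕ → ℝ)) i j
      = if (i, j) ∈ s then c i j else 0 := by
  have term (p : ℕ × ℕ) : (c p.1 p.2 • (Pi.single p.1 (Pi.single p.2 1) : ℕ → ℕ → ℝ)) i j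
      = if (i, j) = p then c i j else 0 := by
    obtain ⟨m, n⟩ := p
    by_cases hm : i = m
    · by_cases hn : j = n <;> simp [hm, hn]
    · simp [hm]
  simp only [Finset.sum_apply, term, Finset.sum_ite_eq]

lemma cornerExpansion_eq_taylorPoly (A : ℕ → ℕ → ℝ) (al e : ℕ → ℝ) (F : ℕ → ℕ → ℝ)
    (G₁ G₃ : ℕ → ℝ) (x y : ℝ) :
    cornerExpansion A al e F G₁ G₃ x y = taylorPoly 6 (cornerJet A al e F G₁ G₃) x y := by
  set t := traceJet A al e F G₁ G₃
  set q := robinJet al t G₁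
  have superposition : cornerExpansion A al e F G₁ G₃ x y = taylorLinear 6 x y (vJetLinear A
      (∑ n ∈ Finset.range 7, t n • (Pi.single n 1, 0, 0)
        + ∑ n ∈ Finset.range 6, q n • (0, Pi.single n 1, 0)
        + ∑ p ∈ Lam 4, F p.1 p.2 • (0, 0, Pi.single p.1 (Pi.single p.2 1)))) := by
    simp only [map_add, map_sum, map_smul, smul_eq_mul, single_single_eq_ite]
    simp only [single_eq_ite, cornerExpansion, GV, QV, zero_ne_one, one_ne_zero, false_and,
      true_and, if_false]
    rfl
  rw [superposition]
  change taylorPoly 6 (vJet A _ _ _) x y = _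
  refine taylorPoly_congr (fun m n hmn => vJet_congr (fun i j hij => ?_) (fun j hj => ?_)
    (fun _ => ?_) fun j hj => ?_) x y <;>
  simp only [Prod.fst_add, Prod.snd_add, Prod.fst_sum, Prod.snd_sum, Prod.smul_fst, Prod.smul_snd,
    smul_zero, Finset.sum_const_zero, add_zero, zero_add, sum_smul_single_apply,
    sum_smul_single_single_apply]
  · exact if_pos (mem_Lam.2 (by omega))
  all_goals exact if_pos (Finset.mem_range.2 (by omega))

lemma taylorPoly_cornerJet_sum_single (A : ℕ → ℕ → ℝ) (al e : ℕ → ℝ) (F : ℕ → ℕ → ℝ)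
    (G₁ G₃ : ℕ → ℝ) (S S₁ S₃ : Finset ℕ) (L : Finset (ℕ × ℕ)) (x y : ℝ) :
    taylorPoly 6 (cornerJet A al (∑ n ∈ S, e n • Pi.single n 1)
        (∑ p ∈ L, F p.1 p.2 • Pi.single p.1 (Pi.single p.2 1))
        (∑ n ∈ S₁, G₁ n • Pi.single n 1) (∑ n ∈ S₃, G₃ n • Pi.single n 1)) x y =
      ∑ n ∈ S, e n * cornerE A al n x y
      + (∑ p ∈ L, F p.1 p.2 * cornerF A al p.1 p.2 x y
        + ∑ n ∈ S₁, G₁ n * cornerG₁ A al n x y + ∑ n ∈ S₃, G₃ n * cornerG₃ A al n x y) := by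
  set D : (ℕ → ℝ) × (ℕ → ℕ → ℝ) × (ℕ → ℝ) × (ℕ → ℝ) :=
    ∑ n ∈ S, e n • (Pi.single n 1, 0, 0, 0)
      + (∑ p ∈ L, F p.1 p.2 • (0, Pi.single p.1 (Pi.single p.2 1), 0, 0)
        + ∑ n ∈ S₁, G₁ n • (0, 0, Pi.single n 1, 0)
        + ∑ n ∈ S₃, G₃ n • (0, 0, 0, Pi.single n 1)) with hD
  have split : (∑ n ∈ S, e n • Pi.single n 1,
      ∑ p ∈ L, F p.1 p.2 • Pi.single p.1 (Pi.single p.2 1),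
      ∑ n ∈ S₁, G₁ n • Pi.single n 1, ∑ n ∈ S₃, G₃ n • Pi.single n 1) = D := by
    refine Prod.ext ?_ (Prod.ext ?_ (Prod.ext ?_ ?_)) <;>
    simp only [Prod.fst_add, Prod.snd_add, Prod.fst_sum, Prod.snd_sum, Prod.smul_fst,
      Prod.smul_snd, smul_zero, Finset.sum_const_zero, add_zero, zero_add, D]
  refine (congrArg (fun D => taylorLinear 6 x y (cornerJetLinear A al D)) split).trans ?_
  simp only [hD, map_add, map_sum, map_smul, smul_eq_mul, single_single_eq_ite]
  simp only [single_eq_ite, cornerE, cornerF, cornerG₁, cornerG₃, cornerExpansion_eq_taylorPoly]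
  rfl

/-- `J` satisfies, up to the order `N`, the differentiated equation and the differentiated Robin
and Neumann conditions, where `A`, `al`, `F`, `G₁`, `G₃` are the jets of `a`, `α`, `f`, `g₁`,
`g₃`. -/
structure FormalSolution (N : ℕ) (A : ℕ → ℕ → ℝ) (al : ℕ → ℝ) (F : ℕ → ℕ → ℝ) (G₁ G₃ : ℕ → ℝ)
    (J : ℕ → ℕ → ℝ) : Prop where
  elliptic : ∀ m n, m + n + 2 ≤ N → divergenceJet A J m n = -F m n
  robin : ∀ n, n + 1 ≤ N → J 1 n = robinJet al (J 0) G₁ n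
  neumann : ∀ m, m + 1 ≤ N → J m 1 = -G₃ m

namespace FormalSolution

lemma congr (h : FormalSolution N A al F G₁ G₃ J) (hF : ∀ m n, m + n + 2 ≤ N → F m n = F' m n)
    (hG₁ : ∀ n, n + 1 ≤ N → G₁ n = G₁' n) (hG₃ : ∀ n, n + 1 ≤ N → G₃ n = G₃' n) :
    FormalSolution N A al F' G₁' G₃' J where
  elliptic m n hmn := by rw [h.elliptic m n hmn, hF m n hmn]
  robin n hn := (h.robin n hn).trans (robinJet_congr (fun _ _ => rfl) (hG₁ n hn))
  neumann m hm := by rw [h.neumann m hm, hG₃ m hm]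

lemma isCornerJet (hA : A 0 0 ≠ 0) (h : FormalSolution N A al F G₁ G₃ J)
    (he : ∀ n ≤ N, Even n → J 0 n = e n) : IsCornerJet N A al e F G₁ G₃ J where
  recursion m n hmn := solveX_of_divergenceJet hA (h.elliptic m n hmn)
  robin := h.robin
  even_trace := he
  odd_trace n hn hodd := by
    refine (vJet_eq_of_solveX (J := fun i j => J j i) (fun i j hij => ?_) (fun _ _ => rfl)
      (fun h => absurd h hodd) fun j hj => (h.neumann j (by omega)).symm).symm
    refine solveX_of_divergenceJet (A := fun i j => A j i) (F := fun i j => F j i)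
      (J := fun i j => J j i) hA ?_
    rw [divergenceJet_swap, h.elliptic j i (by omega)]

theorem taylorPoly_eq (hA : A 0 0 ≠ 0) (h : FormalSolution 6 A al F G₁ G₃ J) (x y : ℝ) :
    taylorPoly 6 J x y = ∑ n ∈ ({0, 2, 4, 6} : Finset ℕ), J 0 n * cornerE A al n x y
      + (∑ p ∈ Lam 4, F p.1 p.2 * cornerF A al p.1 p.2 x y
        + ∑ n ∈ Finset.range 6, G₁ n * cornerG₁ A al n x y
        + ∑ n ∈ Finset.range 6, G₃ n * cornerG₃ A al n x y) := by
  have truncated : IsCornerJet 6 A al (∑ n ∈ {0, 2, 4, 6}, J 0 n • Pi.single n 1)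
      (∑ p ∈ Lam 4, F p.1 p.2 • Pi.single p.1 (Pi.single p.2 1))
      (∑ n ∈ Finset.range 6, G₁ n • Pi.single n 1)
      (∑ n ∈ Finset.range 6, G₃ n • Pi.single n 1) J := by
    refine (h.congr (fun m n hmn => ?_) (fun n hn => ?_) fun n hn => ?_).isCornerJet hA
      fun n hn hev => ?_
    · exact ((sum_smul_single_single_apply ..).trans (if_pos (mem_Lam.2 (by omega)))).symm
    · exact ((sum_smul_single_apply ..).trans (if_pos (Finset.mem_range.2 (by omega)))).symm
    · exact ((sum_smul_single_apply ..).trans (if_pos (Finset.mem_range.2 (by omega)))).symm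
    · refine ((sum_smul_single_apply ..).trans (if_pos ?_)).symm
      interval_cases n <;> simp_all +decide
  rw [taylorPoly_congr fun m n hmn => truncated.eq (isCornerJet_cornerJet ..) hmn]
  exact taylorPoly_cornerJet_sum_single A al (J 0) F G₁ G₃ _ _ _ _ x y

end FormalSolution

end JetRecursion

section DirectionalDerivative

variable {E : Type*} [NormedAddCommGroup E] [NormedSpace ℝ E] {R : Set E} {v : E → ℝ}

/-- The derivative of `v` in the direction `e` at points of `R`, taken from within `R`, so that it
makes sense up to the boundary. -/
noncomputable def dirDeriv (R : Set E) (e : E) (v : E → ℝ) (z : E) : ℝ :=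
  fderivWithin ℝ v R z e

lemma contDiffOn_dirDeriv {n : ℕ} (hR : UniqueDiffOn ℝ R) (e : E)
    (hv : ContDiffOn ℝ ((n + 1 : ℕ) : WithTop ℕ∞) v R) :
    ContDiffOn ℝ (n : WithTop ℕ∞) (dirDeriv R e v) R :=
  (hv.fderivWithin hR (by norm_cast)).clm_apply contDiffOn_const

lemma dirDeriv_comm (hR : UniqueDiffOn ℝ R) (hcl : R ⊆ closure (interior R)) (e e' : E)
    (hv : ContDiffOn ℝ (2 : ℕ) v R) :
    EqOn (dirDeriv R e (dirDeriv R e' v)) (dirDeriv R e' (dirDeriv R e v)) R := by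
  intro z hz
  have hd : DifferentiableWithinAt ℝ (fderivWithin ℝ v R) R z :=
    (hv.fderivWithin (m := 1) hR (by norm_cast)).differentiableOn (by norm_num) z hz
  have hsymm := (hv z hz).isSymmSndFDerivWithinAt (by simp) hR (hcl hz) hz
  unfold dirDeriv
  rw [fderivWithin_clm_apply (hR z hz) hd (differentiableWithinAt_const _),
    fderivWithin_clm_apply (hR z hz) hd (differentiableWithinAt_const _)]
  simpa using hsymm _ _

lemma hasDerivWithinAt_dirDeriv {γ : ℝ → E} {e : E} {S : Set ℝ} {t : ℝ}
    (hv : DifferentiableOn ℝ v R) (hγ : HasDerivWithinAt γ e S t) (hS : MapsTo γ S R)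
    (ht : t ∈ S) : HasDerivWithinAt (fun t => v (γ t)) (dirDeriv R e v (γ t)) S t :=
  (hv _ (hS ht)).hasFDerivWithinAt.comp_hasDerivWithinAt t hγ hS

end DirectionalDerivative

section Jet₁

variable {t₀ s : ℝ} {g g' : ℝ → ℝ} {n : ℕ}

lemma iteratedDerivWithin_Icc_eq_jet₁ (hs : 0 < s) (g : ℝ → ℝ) (n : ℕ) :
    iteratedDerivWithin n g (Icc t₀ (t₀ + s)) t₀ = jet₁ g t₀ n := by
  have hset : Icc t₀ (t₀ + s) =ᶠ[𝓝 t₀] Ici t₀ := by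
    filter_upwards [Iio_mem_nhds (show t₀ < t₀ + s by linarith)] with t ht
    exact propext ⟨fun h => h.1, fun h => ⟨h, (mem_Iio.1 ht).le⟩⟩
  rw [jet₁, iteratedDerivWithin, iteratedDerivWithin, iteratedFDerivWithin_congr_set hset]

lemma contDiffWithinAt_Ici_of_Icc {k : WithTop ℕ∞} (hs : 0 < s)
    (hg : ContDiffOn ℝ k g (Icc t₀ (t₀ + s))) : ContDiffWithinAt ℝ k g (Ici t₀) t₀ :=
  (hg t₀ (by simpa using hs.le)).mono_of_mem_nhdsWithin (Icc_mem_nhdsGE (by linarith))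

lemma jet₁_congr (hs : 0 < s) (h : EqOn g g' (Icc t₀ (t₀ + s))) (n : ℕ) :
    jet₁ g t₀ n = jet₁ g' t₀ n := by
  rw [← iteratedDerivWithin_Icc_eq_jet₁ hs, ← iteratedDerivWithin_Icc_eq_jet₁ hs]
  exact iteratedDerivWithin_congr h (by simpa using hs.le)

lemma jet₁_succ (hs : 0 < s)
    (h : ∀ t ∈ Icc t₀ (t₀ + s), HasDerivWithinAt g (g' t) (Icc t₀ (t₀ + s)) t) (n : ℕ) :
    jet₁ g t₀ (n + 1) = jet₁ g' t₀ n := by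
  rw [← iteratedDerivWithin_Icc_eq_jet₁ hs, ← iteratedDerivWithin_Icc_eq_jet₁ hs,
    iteratedDerivWithin_succ']
  exact iteratedDerivWithin_congr
    (fun t ht => (h t ht).derivWithin (uniqueDiffOn_Icc (by linarith) t ht)) (by simpa using hs.le)

lemma jet₁_neg (g : ℝ → ℝ) (t₀ : ℝ) (n : ℕ) : jet₁ (fun t => -g t) t₀ n = -jet₁ g t₀ n :=
  iteratedDerivWithin_fun_neg _

lemma jet₁_const_mul (c : ℝ) (g : ℝ → ℝ) (t₀ : ℝ) (n : ℕ) :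
    jet₁ (fun t => c * g t) t₀ n = c * jet₁ g t₀ n :=
  iteratedDerivWithin_const_mul_field _ _

lemma jet₁_add (hs : 0 < s) (hg : ContDiffOn ℝ n g (Icc t₀ (t₀ + s)))
    (hg' : ContDiffOn ℝ n g' (Icc t₀ (t₀ + s))) :
    jet₁ (fun t => g t + g' t) t₀ n = jet₁ g t₀ n + jet₁ g' t₀ n :=
  iteratedDerivWithin_fun_add self_mem_Ici (uniqueDiffOn_Ici t₀)
    (contDiffWithinAt_Ici_of_Icc hs hg) (contDiffWithinAt_Ici_of_Icc hs hg')

lemma jet₁_sum {ι : Type*} {I : Finset ι} {f : ι → ℝ → ℝ} (hs : 0 < s)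
    (hf : ∀ i ∈ I, ContDiffOn ℝ n (f i) (Icc t₀ (t₀ + s))) :
    jet₁ (fun t => ∑ i ∈ I, f i t) t₀ n = ∑ i ∈ I, jet₁ (f i) t₀ n :=
  iteratedDerivWithin_fun_sum self_mem_Ici (uniqueDiffOn_Ici t₀)
    fun i hi => contDiffWithinAt_Ici_of_Icc hs (hf i hi)

lemma jet₁_mul (hs : 0 < s) (hg : ContDiffOn ℝ n g (Icc t₀ (t₀ + s)))
    (hg' : ContDiffOn ℝ n g' (Icc t₀ (t₀ + s))) :
    jet₁ (fun t => g t * g' t) t₀ n =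
      ∑ i ∈ Finset.range (n + 1), n.choose i * jet₁ g t₀ i * jet₁ g' t₀ (n - i) :=
  iteratedDerivWithin_mul self_mem_Ici (uniqueDiffOn_Ici t₀)
    (contDiffWithinAt_Ici_of_Icc hs hg) (contDiffWithinAt_Ici_of_Icc hs hg')

end Jet₁

/-- The partial derivative in `x`, taken from within `R`. -/
noncomputable abbrev dx (R : Set (ℝ × ℝ)) : (ℝ × ℝ → ℝ) → ℝ × ℝ → ℝ := dirDeriv R (1, 0)

/-- The partial derivative in `y`, taken from within `R`. -/
noncomputable abbrev dy (R : Set (ℝ × ℝ)) : (ℝ × ℝ → ℝ) → ℝ × ℝ → ℝ := dirDeriv R (0, 1)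

section Jet₂

variable {x₀ y₀ r s : ℝ} {v w : ℝ × ℝ → ℝ} {m n : ℕ}

lemma interior_rect : interior (rect x₀ y₀ r s) = Ioo x₀ (x₀ + r) ×ˢ Ioo y₀ (y₀ + s) := by
  rw [rect, interior_prod_eq, interior_Icc, interior_Icc]

lemma rect_subset_closure_interior (hr : 0 < r) (hs : 0 < s) :
    rect x₀ y₀ r s ⊆ closure (interior (rect x₀ y₀ r s)) := by
  rw [interior_rect, closure_prod_eq, closure_Ioo (by linarith), closure_Ioo (by linarith), rect]

lemma uniqueDiffOn_rect (hr : 0 < r) (hs : 0 < s) : UniqueDiffOn ℝ (rect x₀ y₀ r s) :=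
  (uniqueDiffOn_Icc (by linarith)).prod (uniqueDiffOn_Icc (by linarith))

lemma corner_mem (hr : 0 < r) (hs : 0 < s) : (x₀, y₀) ∈ rect x₀ y₀ r s :=
  ⟨⟨le_rfl, by simpa using hr.le⟩, ⟨le_rfl, by simpa using hs.le⟩⟩

lemma hasDerivWithinAt_dx (hv : DifferentiableOn ℝ v (rect x₀ y₀ r s)) {x y : ℝ}
    (hx : x ∈ Icc x₀ (x₀ + r)) (hy : y ∈ Icc y₀ (y₀ + s)) :
    HasDerivWithinAt (fun x => v (x, y)) (dx (rect x₀ y₀ r s) v (x, y)) (Icc x₀ (x₀ + r)) x :=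
  hasDerivWithinAt_dirDeriv hv ((hasDerivWithinAt_id x _).prodMk (hasDerivWithinAt_const x _ y))
    (fun _ ht => ⟨ht, hy⟩) hx

lemma hasDerivWithinAt_dy (hv : DifferentiableOn ℝ v (rect x₀ y₀ r s)) {x y : ℝ}
    (hx : x ∈ Icc x₀ (x₀ + r)) (hy : y ∈ Icc y₀ (y₀ + s)) :
    HasDerivWithinAt (fun y => v (x, y)) (dy (rect x₀ y₀ r s) v (x, y)) (Icc y₀ (y₀ + s)) y :=
  hasDerivWithinAt_dirDeriv hv ((hasDerivWithinAt_const y _ x).prodMk (hasDerivWithinAt_id y _))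
    (fun _ ht => ⟨hx, ht⟩) hy

lemma contDiffOn_slice {k : WithTop ℕ∞} (hv : ContDiffOn ℝ k v (rect x₀ y₀ r s)) {x : ℝ}
    (hx : x ∈ Icc x₀ (x₀ + r)) : ContDiffOn ℝ k (fun y => v (x, y)) (Icc y₀ (y₀ + s)) :=
  hv.comp (contDiff_const.prodMk contDiff_id).contDiffOn fun _ hy => ⟨hx, hy⟩

lemma jet₁_slice_succ (hs : 0 < s) (hv : DifferentiableOn ℝ v (rect x₀ y₀ r s)) (n : ℕ) {x : ℝ}
    (hx : x ∈ Icc x₀ (x₀ + r)) : jet₁ (fun y => v (x, y)) y₀ (n + 1) =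
      jet₁ (fun y => dy (rect x₀ y₀ r s) v (x, y)) y₀ n :=
  jet₁_succ hs (fun _ hy => hasDerivWithinAt_dy hv hx hy) n

lemma contDiffOn_jet₁_slice (hr : 0 < r) (hs : 0 < s)
    (hv : ContDiffOn ℝ ((m + n : ℕ) : WithTop ℕ∞) v (rect x₀ y₀ r s)) :
    ContDiffOn ℝ m (fun x => jet₁ (fun y => v (x, y)) y₀ n) (Icc x₀ (x₀ + r)) := by
  induction n generalizing v with
  | zero =>
    have hy₀ : y₀ ∈ Icc y₀ (y₀ + s) := by simpa using hs.le
    simpa [jet₁, Function.comp_def] using hv.comp (contDiff_id.prodMk contDiff_const).contDiffOn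
      fun x (hx : x ∈ Icc x₀ (x₀ + r)) => (⟨hx, hy₀⟩ : (x, y₀) ∈ rect x₀ y₀ r s)
  | succ n ih =>
    exact (ih (contDiffOn_dirDeriv (uniqueDiffOn_rect hr hs) _ hv)).congr fun x hx =>
      jet₁_slice_succ hs (hv.differentiableOn (by norm_cast)) n hx

lemma hasDerivWithinAt_jet₁_slice (hr : 0 < r) (hs : 0 < s)
    (hv : ContDiffOn ℝ ((n + 1 : ℕ) : WithTop ℕ∞) v (rect x₀ y₀ r s)) {x : ℝ}
    (hx : x ∈ Icc x₀ (x₀ + r)) : HasDerivWithinAt (fun x => jet₁ (fun y => v (x, y)) y₀ n)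
      (jet₁ (fun y => dx (rect x₀ y₀ r s) v (x, y)) y₀ n) (Icc x₀ (x₀ + r)) x := by
  have hR := uniqueDiffOn_rect (x₀ := x₀) (y₀ := y₀) hr hs
  have hd : DifferentiableOn ℝ v (rect x₀ y₀ r s) := hv.differentiableOn (by norm_cast)
  induction n generalizing v with
  | zero => simpa [jet₁] using hasDerivWithinAt_dx hd hx (left_mem_Icc.2 (by linarith))
  | succ n ih =>
    have hdx := contDiffOn_dirDeriv hR (1, 0) hv
    have hdy := contDiffOn_dirDeriv hR (0, 1) hv
    have hcomm := dirDeriv_comm hR (rect_subset_closure_interior hr hs) (1, 0) (0, 1)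
      (hv.of_le (by norm_cast; omega))
    rw [jet₁_slice_succ hs (hdx.differentiableOn (by norm_cast)) n hx,
      ← jet₁_congr hs (fun y hy => hcomm (⟨hx, hy⟩ : (x, y) ∈ rect x₀ y₀ r s)) n]
    exact (ih hdy (hdy.differentiableOn (by norm_cast))).congr
      (fun _ hx' => jet₁_slice_succ hs hd n hx') (jet₁_slice_succ hs hd n hx)

lemma jet₂_eq_jet₁ (v : ℝ × ℝ → ℝ) (x₀ y₀ : ℝ) (m n : ℕ) :
    jet₂ v x₀ y₀ m n = jet₁ (fun x => jet₁ (fun y => v (x, y)) y₀ n) x₀ m := rfl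

lemma jet₂_congr (hr : 0 < r) (hs : 0 < s) (h : EqOn v w (rect x₀ y₀ r s)) (m n : ℕ) :
    jet₂ v x₀ y₀ m n = jet₂ w x₀ y₀ m n :=
  jet₁_congr hr (fun _ hx => jet₁_congr hs (fun _ hy => h ⟨hx, hy⟩) n) m

lemma jet₂_dx (hr : 0 < r) (hs : 0 < s)
    (hv : ContDiffOn ℝ ((n + 1 : ℕ) : WithTop ℕ∞) v (rect x₀ y₀ r s)) (m : ℕ) :
    jet₂ (dx (rect x₀ y₀ r s) v) x₀ y₀ m n = jet₂ v x₀ y₀ (m + 1) n :=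
  (jet₁_succ hr (fun _ hx => hasDerivWithinAt_jet₁_slice hr hs hv hx) m).symm

lemma jet₂_dy (hr : 0 < r) (hs : 0 < s) (hv : DifferentiableOn ℝ v (rect x₀ y₀ r s)) (m n : ℕ) :
    jet₂ (dy (rect x₀ y₀ r s) v) x₀ y₀ m n = jet₂ v x₀ y₀ m (n + 1) :=
  (jet₁_congr hr (fun _ hx => jet₁_slice_succ hs hv n hx) m).symm

lemma jet₂_neg (v : ℝ × ℝ → ℝ) (x₀ y₀ : ℝ) (m n : ℕ) :
    jet₂ (fun z => -v z) x₀ y₀ m n = -jet₂ v x₀ y₀ m n := by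
  simp only [jet₂_eq_jet₁, jet₁_neg]

lemma jet₂_const_mul (c : ℝ) (v : ℝ × ℝ → ℝ) (x₀ y₀ : ℝ) (m n : ℕ) :
    jet₂ (fun z => c * v z) x₀ y₀ m n = c * jet₂ v x₀ y₀ m n := by
  simp only [jet₂_eq_jet₁, jet₁_const_mul]

lemma jet₂_add (hr : 0 < r) (hs : 0 < s)
    (hv : ContDiffOn ℝ ((m + n : ℕ) : WithTop ℕ∞) v (rect x₀ y₀ r s))
    (hw : ContDiffOn ℝ ((m + n : ℕ) : WithTop ℕ∞) w (rect x₀ y₀ r s)) :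
    jet₂ (fun z => v z + w z) x₀ y₀ m n = jet₂ v x₀ y₀ m n + jet₂ w x₀ y₀ m n := by
  have hn : ((n : ℕ) : WithTop ℕ∞) ≤ ((m + n : ℕ) : WithTop ℕ∞) := by norm_cast; omega
  simp only [jet₂_eq_jet₁]
  rw [← jet₁_add hr (contDiffOn_jet₁_slice hr hs hv) (contDiffOn_jet₁_slice hr hs hw)]
  exact jet₁_congr hr (fun x hx => jet₁_add hs (contDiffOn_slice (hv.of_le hn) hx)
    (contDiffOn_slice (hw.of_le hn) hx)) m

lemma jet₂_mul (hr : 0 < r) (hs : 0 < s)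
    (hv : ContDiffOn ℝ ((m + n : ℕ) : WithTop ℕ∞) v (rect x₀ y₀ r s))
    (hw : ContDiffOn ℝ ((m + n : ℕ) : WithTop ℕ∞) w (rect x₀ y₀ r s)) :
    jet₂ (fun z => v z * w z) x₀ y₀ m n =
      ∑ i ∈ Finset.range (m + 1), ∑ j ∈ Finset.range (n + 1), (m.choose i : ℝ) * n.choose j *
        (jet₂ v x₀ y₀ i j * jet₂ w x₀ y₀ (m - i) (n - j)) := by
  have hn : ((n : ℕ) : WithTop ℕ∞) ≤ ((m + n : ℕ) : WithTop ℕ∞) := by norm_cast; omega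
  have hslice {u : ℝ × ℝ → ℝ} {j : ℕ} (hj : j ≤ n)
      (hu : ContDiffOn ℝ ((m + n : ℕ) : WithTop ℕ∞) u (rect x₀ y₀ r s)) :
      ContDiffOn ℝ m (fun x => jet₁ (fun y => u (x, y)) y₀ j) (Icc x₀ (x₀ + r)) :=
    contDiffOn_jet₁_slice hr hs (hu.of_le (by norm_cast; omega))
  have hinner : EqOn (fun x => jet₁ (fun y => v (x, y) * w (x, y)) y₀ n)
      (fun x => ∑ j ∈ Finset.range (n + 1), (n.choose j : ℝ) *
        (jet₁ (fun y => v (x, y)) y₀ j * jet₁ (fun y => w (x, y)) y₀ (n - j)))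
      (Icc x₀ (x₀ + r)) := fun x hx => by
    simpa only [mul_assoc] using jet₁_mul hs (contDiffOn_slice (hv.of_le hn) hx)
      (contDiffOn_slice (hw.of_le hn) hx)
  rw [jet₂_eq_jet₁, jet₁_congr hr hinner, jet₁_sum hr, Finset.sum_comm]
  · refine Finset.sum_congr rfl fun j hj => ?_
    have hj : j ≤ n := Nat.lt_succ_iff.1 (Finset.mem_range.1 hj)
    rw [jet₁_const_mul, jet₁_mul hr (hslice hj hv) (hslice (n.sub_le j) hw), Finset.mul_sum]
    exact Finset.sum_congr rfl fun i _ => by simp only [jet₂_eq_jet₁]; ring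
  · exact fun j hj => contDiffOn_const.mul
      ((hslice (Nat.lt_succ_iff.1 (Finset.mem_range.1 hj)) hv).mul (hslice (n.sub_le j) hw))

end Jet₂

section Taylor

open Finset.HasAntidiagonal (antidiagonal)

variable {x₀ y₀ r s : ℝ} {v : ℝ × ℝ → ℝ} {n d : ℕ}

/-- The part of `taylorPoly` that is homogeneous of degree `n`. -/
noncomputable def taylorForm (J : ℕ → ℕ → ℝ) (n : ℕ) (x y : ℝ) : ℝ :=
  ∑ p ∈ antidiagonal n,
    J p.1 p.2 * x ^ p.1 * y ^ p.2 / ((p.1.factorial : ℝ) * (p.2.factorial : ℝ))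

lemma taylorPoly_eq_sum_taylorForm (d : ℕ) (J : ℕ → ℕ → ℝ) (x y : ℝ) :
    taylorPoly d J x y = ∑ n ∈ Finset.range (d + 1), taylorForm J n x y := by
  have hmaps : ∀ p ∈ Lam d, p.1 + p.2 ∈ Finset.range (d + 1) := fun p hp => by
    have := mem_Lam.1 hp
    simp only [Finset.mem_range]; omega
  rw [taylorPoly, ← Finset.sum_fiberwise_of_maps_to hmaps]
  refine Finset.sum_congr rfl fun n hn => Finset.sum_congr ?_ fun _ _ => rfl
  ext p
  simp only [Finset.mem_filter, mem_Lam, Finset.HasAntidiagonal.mem_antidiagonal,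
    Finset.mem_range] at hn ⊢
  omega

lemma taylorForm_mul (J : ℕ → ℕ → ℝ) (n : ℕ) (x y h : ℝ) :
    taylorForm J n (x * h) (y * h) = taylorForm J n x y * h ^ n := by
  rw [taylorForm, taylorForm, Finset.sum_mul]
  refine Finset.sum_congr rfl fun p hp => ?_
  rw [← Finset.HasAntidiagonal.mem_antidiagonal.1 hp]
  ring

lemma taylorForm_eq_sum_choose (J : ℕ → ℕ → ℝ) (n : ℕ) (x y : ℝ) :
    taylorForm J n x y = (n.factorial : ℝ)⁻¹ *
      ∑ p ∈ antidiagonal n, n.choose p.1 * (x ^ p.1 * y ^ p.2 * J p.1 p.2) := by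
  rw [taylorForm, Finset.mul_sum]
  refine Finset.sum_congr rfl fun p hp => ?_
  rw [← Finset.HasAntidiagonal.mem_antidiagonal.1 hp, Nat.cast_add_choose]
  field_simp

variable {a b ρ : ℝ}

lemma mapsTo_ray (ha : 0 ≤ a) (hb : 0 ≤ b) (har : a * ρ ≤ r) (hbs : b * ρ ≤ s) :
    MapsTo (fun t => (x₀ + a * t, y₀ + b * t)) (Icc 0 (0 + ρ)) (rect x₀ y₀ r s) := by
  intro t ⟨ht₀, ht⟩
  have hat := mul_le_mul_of_nonneg_left ht ha
  have hbt := mul_le_mul_of_nonneg_left ht hb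
  have := mul_nonneg ha ht₀
  have := mul_nonneg hb ht₀
  rw [zero_add] at hat hbt
  refine ⟨⟨?_, ?_⟩, ?_, ?_⟩ <;> dsimp only <;> linarith

lemma contDiffOn_ray (ha : 0 ≤ a) (hb : 0 ≤ b) (har : a * ρ ≤ r) (hbs : b * ρ ≤ s)
    {k : WithTop ℕ∞} (hv : ContDiffOn ℝ k v (rect x₀ y₀ r s)) :
    ContDiffOn ℝ k (fun t => v (x₀ + a * t, y₀ + b * t)) (Icc 0 (0 + ρ)) :=
  hv.comp (by fun_prop) (mapsTo_ray ha hb har hbs)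

lemma hasDerivWithinAt_ray (ha : 0 ≤ a) (hb : 0 ≤ b) (har : a * ρ ≤ r) (hbs : b * ρ ≤ s)
    (hv : DifferentiableOn ℝ v (rect x₀ y₀ r s)) {t : ℝ} (ht : t ∈ Icc 0 (0 + ρ)) :
    HasDerivWithinAt (fun t => v (x₀ + a * t, y₀ + b * t))
      (a * dx (rect x₀ y₀ r s) v (x₀ + a * t, y₀ + b * t)
        + b * dy (rect x₀ y₀ r s) v (x₀ + a * t, y₀ + b * t)) (Icc 0 (0 + ρ)) t := by
  have hline (x₀ a : ℝ) : HasDerivWithinAt (fun t => x₀ + a * t) a (Icc 0 (0 + ρ)) t := by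
    simpa using ((hasDerivWithinAt_id t (Icc 0 (0 + ρ))).const_mul a).const_add x₀
  have hv := hasDerivWithinAt_dirDeriv hv ((hline x₀ a).prodMk (hline y₀ b))
    (mapsTo_ray ha hb har hbs) ht
  have he : ((a, b) : ℝ × ℝ) = a • (1, 0) + b • (0, 1) := by simp
  simpa only [dirDeriv, he, map_add, map_smul, smul_eq_mul] using hv

lemma jet₁_ray (hr : 0 < r) (hs : 0 < s) (hρ : 0 < ρ) (ha : 0 ≤ a) (hb : 0 ≤ b)
    (har : a * ρ ≤ r) (hbs : b * ρ ≤ s) (hv : ContDiffOn ℝ n v (rect x₀ y₀ r s)) :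
    jet₁ (fun t => v (x₀ + a * t, y₀ + b * t)) 0 n =
      ∑ p ∈ antidiagonal n, n.choose p.1 * (a ^ p.1 * b ^ p.2 * jet₂ v x₀ y₀ p.1 p.2) := by
  induction n generalizing v with
  | zero => simp [jet₁, jet₂]
  | succ n ih =>
    have hR := uniqueDiffOn_rect (x₀ := x₀) (y₀ := y₀) hr hs
    have hd : DifferentiableOn ℝ v (rect x₀ y₀ r s) := hv.differentiableOn (by norm_cast)
    have hdx := contDiffOn_dirDeriv hR (1, 0) hv
    have hdy := contDiffOn_dirDeriv hR (0, 1) hv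
    rw [jet₁_succ hρ (fun t ht => hasDerivWithinAt_ray ha hb har hbs hd ht) n,
      ih (v := fun z => a * dx (rect x₀ y₀ r s) v z + b * dy (rect x₀ y₀ r s) v z)
        ((contDiffOn_const.mul hdx).add (contDiffOn_const.mul hdy)),
      Finset.sum_antidiagonal_choose_succ_mul (fun i j => a ^ i * b ^ j * jet₂ v x₀ y₀ i j),
      ← Finset.sum_add_distrib]
    refine Finset.sum_congr rfl fun p hp => ?_
    have hp := Finset.HasAntidiagonal.mem_antidiagonal.1 hp
    rw [← hp] at hdx hdy
    rw [jet₂_add hr hs (contDiffOn_const.mul hdx) (contDiffOn_const.mul hdy), jet₂_const_mul,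
      jet₂_const_mul, jet₂_dx hr hs (hv.of_le (by norm_cast; omega)), jet₂_dy hr hs hd,
      Nat.choose_symm_of_eq_add hp.symm]
    ring

lemma isBigO_sub_taylorPoly (hr : 0 < r) (hs : 0 < s) (ha : 0 ≤ a) (hb : 0 ≤ b)
    (hv : ContDiffOn ℝ ((d + 1 : ℕ) : WithTop ℕ∞) v (rect x₀ y₀ r s)) :
    (fun h => v (x₀ + a * h, y₀ + b * h) - taylorPoly d (jet₂ v x₀ y₀) (a * h) (b * h))
      =O[𝓝[>] 0] fun h => h ^ (d + 1) := by
  obtain ⟨ρ, hρ, har, hbs⟩ : ∃ ρ > 0, a * ρ ≤ r ∧ b * ρ ≤ s := by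
    have hsmall (c q : ℝ) (hq : 0 < q) : ∀ᶠ ρ in 𝓝[>] 0, c * ρ < q :=
      nhdsWithin_le_nhds ((continuous_const_mul c).continuousAt.eventually_lt_const (by simpa))
    obtain ⟨ρ, ⟨har, hbs⟩, hρ⟩ := (((hsmall a r hr).and (hsmall b s hs)).and
      self_mem_nhdsWithin).exists
    exact ⟨ρ, hρ, har.le, hbs.le⟩
  obtain ⟨C, hC⟩ := exists_taylor_mean_remainder_bound (n := d)
    (show 0 ≤ 0 + ρ by simpa using hρ.le) (contDiffOn_ray ha hb har hbs (by exact_mod_cast hv))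
  have htaylor (h : ℝ) : taylorWithinEval (fun t => v (x₀ + a * t, y₀ + b * t)) d
      (Icc 0 (0 + ρ)) 0 h = taylorPoly d (jet₂ v x₀ y₀) (a * h) (b * h) := by
    rw [taylor_within_apply, taylorPoly_eq_sum_taylorForm]
    refine Finset.sum_congr rfl fun n hn => ?_
    have hn := Finset.mem_range.1 hn
    rw [iteratedDerivWithin_Icc_eq_jet₁ hρ,
      jet₁_ray hr hs hρ ha hb har hbs (hv.of_le (by norm_cast; omega)), taylorForm_mul,
      taylorForm_eq_sum_choose, sub_zero, smul_eq_mul]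
    ring
  refine IsBigO.of_bound C ?_
  filter_upwards [Ioo_mem_nhdsGT (show (0 : ℝ) < 0 + ρ by simpa using hρ)] with h hh
  have := hC h (Ioo_subset_Icc_self hh)
  rwa [htaylor, sub_zero, ← Real.norm_of_nonneg (pow_nonneg hh.1.le (d + 1))] at this

end Taylor

section SolutionJets

variable {j k : ℕ∞} {x₀ y₀ r s : ℝ} {a u f : ℝ × ℝ → ℝ} {α g₁ g₃ : ℝ → ℝ} {m n : ℕ}

lemma Coefficients.mono (h : Coefficients k x₀ y₀ r s a α) (hjk : j ≤ k) :
    Coefficients j x₀ y₀ r s a α where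
  contDiffOn_a := h.contDiffOn_a.of_le (by exact_mod_cast add_le_add_left hjk 1)
  contDiffOn_α := h.contDiffOn_α.of_le (by exact_mod_cast hjk)
  a_pos := h.a_pos

lemma Coefficients.jet₂_zero_zero_ne (h : Coefficients k x₀ y₀ r s a α) (hr : 0 < r)
    (hs : 0 < s) : jet₂ a x₀ y₀ 0 0 ≠ 0 :=
  (h.a_pos _ (corner_mem hr hs)).ne'

lemma Solution.mono (h : Solution k x₀ y₀ r s a α u f g₁ g₃) (hjk : j ≤ k) :
    Solution j x₀ y₀ r s a α u f g₁ g₃ where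
  __ := h
  contDiffOn_u := h.contDiffOn_u.of_le (by exact_mod_cast add_le_add_left hjk 2)
  contDiffOn_f := h.contDiffOn_f.of_le (by exact_mod_cast hjk)
  contDiffOn_g₁ := h.contDiffOn_g₁.of_le (by exact_mod_cast hjk)
  contDiffOn_g₃ := h.contDiffOn_g₃.of_le (by exact_mod_cast hjk)

/-- `∇·(a∇u)`, expanded by the product rule, with derivatives taken from within `R`. -/
noncomputable def divergence (R : Set (ℝ × ℝ)) (a u : ℝ × ℝ → ℝ) (z : ℝ × ℝ) : ℝ :=
  a z * (dx R (dx R u) z + dy R (dy R u) z) + (dx R a z * dx R u z + dy R a z * dy R u z)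

lemma jet₂_divergence (hr : 0 < r) (hs : 0 < s)
    (ha : ContDiffOn ℝ ((m + n + 1 : ℕ) : WithTop ℕ∞) a (rect x₀ y₀ r s))
    (hu : ContDiffOn ℝ ((m + n + 2 : ℕ) : WithTop ℕ∞) u (rect x₀ y₀ r s)) :
    jet₂ (divergence (rect x₀ y₀ r s) a u) x₀ y₀ m n =
      divergenceJet (jet₂ a x₀ y₀) (jet₂ u x₀ y₀) m n := by
  have hR := uniqueDiffOn_rect (x₀ := x₀) (y₀ := y₀) hr hs
  have ha₀ : ContDiffOn ℝ ((m + n : ℕ) : WithTop ℕ∞) a (rect x₀ y₀ r s) :=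
    ha.of_le (by norm_cast; omega)
  have hda (e) := contDiffOn_dirDeriv hR e ha
  have hdu (e) := contDiffOn_dirDeriv hR e hu
  have hdu₀ (e) := (hdu e).of_le (show ((m + n : ℕ) : WithTop ℕ∞) ≤ _ by norm_cast; omega)
  have hddu (e) := contDiffOn_dirDeriv hR e (hdu e)
  unfold divergence
  rw [jet₂_add hr hs (ha₀.mul ((hddu _).add (hddu _)))
      (((hda _).mul (hdu₀ _)).add ((hda _).mul (hdu₀ _))),
    jet₂_add hr hs ((hda _).mul (hdu₀ _)) ((hda _).mul (hdu₀ _)),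
    jet₂_mul hr hs ha₀ ((hddu _).add (hddu _)), jet₂_mul hr hs (hda _) (hdu₀ _),
    jet₂_mul hr hs (hda _) (hdu₀ _)]
  simp only [divergenceJet, ← Finset.sum_add_distrib, ← mul_add]
  refine Finset.sum_congr rfl fun i hi => Finset.sum_congr rfl fun j hj => ?_
  have hi := Finset.mem_range.1 hi
  have hj := Finset.mem_range.1 hj
  have hle {M N : ℕ} (h : M ≤ N) : ((M : ℕ) : WithTop ℕ∞) ≤ N := by exact_mod_cast h
  have hd (e) : DifferentiableOn ℝ (dirDeriv (rect x₀ y₀ r s) e u) (rect x₀ y₀ r s) :=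
    (hdu e).differentiableOn (by norm_cast)
  rw [jet₂_add hr hs ((hddu _).of_le (hle (by omega))) ((hddu _).of_le (hle (by omega))),
    jet₂_dx hr hs ((hdu _).of_le (hle (by omega))), jet₂_dx hr hs (hu.of_le (hle (by omega))),
    jet₂_dx hr hs (hu.of_le (hle (by omega))), jet₂_dx hr hs (ha.of_le (hle (by omega))),
    jet₂_dy hr hs (hd _), jet₂_dy hr hs (hu.differentiableOn (by norm_cast)),
    jet₂_dy hr hs (hu.differentiableOn (by norm_cast)),
    jet₂_dy hr hs (ha.differentiableOn (by norm_cast)), jetTerm]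
  ring

lemma deriv_mul_deriv {A U U' : ℝ → ℝ} {A' U'' x : ℝ} (hA : HasDerivAt A A' x)
    (hU : ∀ᶠ t in 𝓝 x, HasDerivAt U (U' t) t) (hU' : HasDerivAt U' U'' x) :
    deriv (fun t => A t * deriv U t) x = A' * U' x + A x * U'' :=
  ((hA.mul hU').congr_of_eventuallyEq (hU.mono fun t ht => by simp [ht.deriv])).deriv

lemma derivWithin_Ici_eq {g : ℝ → ℝ} {g' t₀ : ℝ} (hs : 0 < s)
    (hg : HasDerivWithinAt g g' (Icc t₀ (t₀ + s)) t₀) : derivWithin g (Ici t₀) t₀ = g' :=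
  (hg.mono_of_mem_nhdsWithin (Icc_mem_nhdsGE (by linarith))).derivWithin
    (uniqueDiffWithinAt_Ici t₀)

lemma eqOn_Icc_of_eqOn_Ioo {g g' : ℝ → ℝ} {t₀ : ℝ} (hs : 0 < s)
    (h : EqOn g g' (Ioo t₀ (t₀ + s))) (hg : ContinuousOn g (Icc t₀ (t₀ + s)))
    (hg' : ContinuousOn g' (Icc t₀ (t₀ + s))) : EqOn g g' (Icc t₀ (t₀ + s)) :=
  h.of_subset_closure hg hg' Ioo_subset_Icc_self (closure_Ioo (by linarith)).ge

lemma Solution.eqOn_divergence (hr : 0 < r) (hs : 0 < s) (hc : Coefficients 0 x₀ y₀ r s a α)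
    (h : Solution 0 x₀ y₀ r s a α u f g₁ g₃) :
    EqOn (divergence (rect x₀ y₀ r s) a u) (fun z => -f z) (rect x₀ y₀ r s) := by
  have hR := uniqueDiffOn_rect (x₀ := x₀) (y₀ := y₀) hr hs
  have ha : ContDiffOn ℝ ((0 + 1 : ℕ) : WithTop ℕ∞) a (rect x₀ y₀ r s) := by
    exact_mod_cast hc.contDiffOn_a
  have hu : ContDiffOn ℝ ((0 + 1 + 1 : ℕ) : WithTop ℕ∞) u (rect x₀ y₀ r s) := by
    exact_mod_cast h.contDiffOn_u
  have hda (e) := (contDiffOn_dirDeriv hR e ha).continuousOn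
  have hdu (e) := contDiffOn_dirDeriv hR e hu
  have hddu (e) := (contDiffOn_dirDeriv hR e (hdu e)).continuousOn
  have had := ha.differentiableOn (by norm_cast)
  have hud := hu.differentiableOn (by norm_cast)
  have hdud (e) := (hdu e).differentiableOn (by norm_cast)
  refine EqOn.of_subset_closure (s := interior (rect x₀ y₀ r s)) ?_ ?_
    h.contDiffOn_f.continuousOn.neg interior_subset (rect_subset_closure_interior hr hs)
  · rw [interior_rect]
    rintro ⟨x, y⟩ ⟨hx, hy⟩
    have hdx {v : ℝ × ℝ → ℝ} (hv : DifferentiableOn ℝ v (rect x₀ y₀ r s)) {t : ℝ}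
        (ht : t ∈ Ioo x₀ (x₀ + r)) :
        HasDerivAt (fun t => v (t, y)) (dx (rect x₀ y₀ r s) v (t, y)) t :=
      (hasDerivWithinAt_dx hv (Ioo_subset_Icc_self ht) (Ioo_subset_Icc_self hy)).hasDerivAt
        (Icc_mem_nhds ht.1 ht.2)
    have hdy {v : ℝ × ℝ → ℝ} (hv : DifferentiableOn ℝ v (rect x₀ y₀ r s)) {t : ℝ}
        (ht : t ∈ Ioo y₀ (y₀ + s)) :
        HasDerivAt (fun t => v (x, t)) (dy (rect x₀ y₀ r s) v (x, t)) t :=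
      (hasDerivWithinAt_dy hv (Ioo_subset_Icc_self hx) (Ioo_subset_Icc_self ht)).hasDerivAt
        (Icc_mem_nhds ht.1 ht.2)
    change _ = -f (x, y)
    rw [← h.pde x hx y hy, deriv_mul_deriv (hdx had hx)
        (eventually_of_mem (Ioo_mem_nhds hx.1 hx.2) fun _ => hdx hud) (hdx (hdud _) hx),
      deriv_mul_deriv (hdy had hy)
        (eventually_of_mem (Ioo_mem_nhds hy.1 hy.2) fun _ => hdy hud) (hdy (hdud _) hy), divergence]
    ring
  · exact (ha.continuousOn.mul ((hddu _).add (hddu _))).add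
      (((hda _).mul (hdu _).continuousOn).add ((hda _).mul (hdu _).continuousOn))

lemma Solution.divergenceJet_eq (hr : 0 < r) (hs : 0 < s)
    (hc : Coefficients (m + n : ℕ) x₀ y₀ r s a α)
    (h : Solution (m + n : ℕ) x₀ y₀ r s a α u f g₁ g₃) :
    divergenceJet (jet₂ a x₀ y₀) (jet₂ u x₀ y₀) m n = -jet₂ f x₀ y₀ m n := by
  rw [← jet₂_neg, ← jet₂_congr hr hs
      (Solution.eqOn_divergence hr hs (hc.mono zero_le) (h.mono zero_le)),
    jet₂_divergence hr hs (by exact_mod_cast hc.contDiffOn_a) (by exact_mod_cast h.contDiffOn_u)]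

lemma Solution.robinJet_eq (hr : 0 < r) (hs : 0 < s) (hc : Coefficients n x₀ y₀ r s a α)
    (h : Solution n x₀ y₀ r s a α u f g₁ g₃) :
    jet₂ u x₀ y₀ 1 n = robinJet (jet₁ α y₀) (jet₂ u x₀ y₀ 0) (jet₁ g₁ y₀) n := by
  have hx₀ : x₀ ∈ Icc x₀ (x₀ + r) := left_mem_Icc.2 (by linarith)
  have hu : ContDiffOn ℝ ((n + 1 : ℕ) : WithTop ℕ∞) u (rect x₀ y₀ r s) :=
    h.contDiffOn_u.of_le (by norm_cast; omega)
  have hud := hu.differentiableOn (by norm_cast)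
  have hdx := contDiffOn_slice (contDiffOn_dirDeriv (uniqueDiffOn_rect hr hs) (1, 0) hu) hx₀
  have hu₀ := contDiffOn_slice (hu.of_le (m := n) (by norm_cast; omega)) hx₀
  have hαu := hc.contDiffOn_α.mul hu₀
  have hrobin : EqOn (fun y => dx (rect x₀ y₀ r s) u (x₀, y))
      (fun y => α y * u (x₀, y) + -g₁ y) (Icc y₀ (y₀ + s)) := by
    refine eqOn_Icc_of_eqOn_Ioo hs (fun y hy => ?_) hdx.continuousOn
      (hαu.add h.contDiffOn_g₁.neg).continuousOn
    have := h.robin y hy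
    rw [derivWithin_Ici_eq hr (hasDerivWithinAt_dx hud hx₀ (Ioo_subset_Icc_self hy))] at this
    linarith
  rw [← zero_add 1, ← jet₂_dx hr hs hu 0]
  change jet₁ _ y₀ n = _
  rw [jet₁_congr hs hrobin, jet₁_add hs hαu h.contDiffOn_g₁.neg, jet₁_neg,
    jet₁_mul hs hc.contDiffOn_α hu₀, robinJet, sub_eq_add_neg, ← Finset.sum_range_reflect]
  congr 1
  refine Finset.sum_congr rfl fun i hi => ?_
  have hi : i ≤ n := Nat.lt_succ_iff.1 (Finset.mem_range.1 hi)
  rw [Nat.add_sub_cancel, Nat.choose_symm hi, Nat.sub_sub_self hi]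
  rfl

lemma Solution.neumannJet_eq (hr : 0 < r) (hs : 0 < s)
    (h : Solution m x₀ y₀ r s a α u f g₁ g₃) :
    jet₂ u x₀ y₀ m 1 = -jet₁ g₃ x₀ m := by
  have hy₀ : y₀ ∈ Icc y₀ (y₀ + s) := left_mem_Icc.2 (by linarith)
  have hu : ContDiffOn ℝ ((1 + 1 : ℕ) : WithTop ℕ∞) u (rect x₀ y₀ r s) :=
    h.contDiffOn_u.of_le (by norm_cast; exact Nat.cast_le.2 (by omega))
  have hud := hu.differentiableOn (by norm_cast)
  have hdy : ContinuousOn (fun x => dy (rect x₀ y₀ r s) u (x, y₀)) (Icc x₀ (x₀ + r)) :=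
    (contDiffOn_dirDeriv (uniqueDiffOn_rect hr hs) (0, 1) hu).continuousOn.comp
      (by fun_prop) fun x hx => ⟨hx, hy₀⟩
  have hneumann : EqOn (fun x => dy (rect x₀ y₀ r s) u (x, y₀)) (fun x => -g₃ x)
      (Icc x₀ (x₀ + r)) := by
    refine eqOn_Icc_of_eqOn_Ioo hr (fun x hx => ?_) hdy h.contDiffOn_g₃.continuousOn.neg
    have := h.neumann x hx
    rw [derivWithin_Ici_eq hs (hasDerivWithinAt_dy hud (Ioo_subset_Icc_self hx) hy₀)] at this
    linarith
  rw [← zero_add 1, ← jet₂_dy hr hs hud, ← jet₁_neg]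
  exact jet₁_congr hr hneumann m

lemma Solution.formalSolution {k : ℕ} (hr : 0 < r) (hs : 0 < s)
    (hc : Coefficients k x₀ y₀ r s a α) (h : Solution k x₀ y₀ r s a α u f g₁ g₃) :
    FormalSolution (k + 1) (jet₂ a x₀ y₀) (jet₁ α y₀) (jet₂ f x₀ y₀) (jet₁ g₁ y₀) (jet₁ g₃ x₀)
      (jet₂ u x₀ y₀) where
  elliptic m n hmn :=
    have hle : ((m + n : ℕ) : ℕ∞) ≤ k := by norm_cast; omega
    Solution.divergenceJet_eq hr hs (hc.mono hle) (h.mono hle)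
  robin n hn :=
    have hle : (n : ℕ∞) ≤ k := by norm_cast; omega
    Solution.robinJet_eq hr hs (hc.mono hle) (h.mono hle)
  neumann m hm := Solution.neumannJet_eq hr hs (h.mono (by norm_cast; omega))

end SolutionJets

section Consistency

variable {A F J : ℕ → ℕ → ℝ} {al G₁ G₃ : ℕ → ℝ} {c : Fin 2 → Fin 2 → Fin 7 → ℝ} {l : Filter ℝ}

lemma stencilSum_add (c : Fin 2 → Fin 2 → Fin 7 → ℝ) (E E' : ℝ → ℝ → ℝ) (h : ℝ) :
    stencilSum c (fun x y => E x y + E' x y) h = stencilSum c E h + stencilSum c E' h := by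
  simp only [stencilSum, mul_add, Finset.sum_add_distrib]

lemma stencilSum_sum_mul {ι : Type*} (c : Fin 2 → Fin 2 → Fin 7 → ℝ) (I : Finset ι) (b : ι → ℝ)
    (E : ι → ℝ → ℝ → ℝ) (h : ℝ) :
    stencilSum c (fun x y => ∑ i ∈ I, b i * E i x y) h = ∑ i ∈ I, b i * stencilSum c (E i) h := by
  simp only [stencilSum, Fin.sum_univ_two, Finset.mul_sum, ← Finset.sum_add_distrib]
  exact Finset.sum_congr rfl fun i _ => by ring

lemma FormalSolution.stencilSum_taylorPoly (hA : A 0 0 ≠ 0)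
    (hJ : FormalSolution 6 A al F G₁ G₃ J) (c : Fin 2 → Fin 2 → Fin 7 → ℝ) (h : ℝ) :
    stencilSum c (taylorPoly 6 J) h =
      ∑ n ∈ ({0, 2, 4, 6} : Finset ℕ), J 0 n * stencilSum c (cornerE A al n) h
      + (∑ p ∈ Lam 4, F p.1 p.2 * stencilSum c (cornerF A al p.1 p.2) h
        + ∑ n ∈ Finset.range 6, G₁ n * stencilSum c (cornerG₁ A al n) h
        + ∑ n ∈ Finset.range 6, G₃ n * stencilSum c (cornerG₃ A al n) h) := by
  simp only [← stencilSum_sum_mul, ← stencilSum_add]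
  exact congrArg (stencilSum c · h) (funext₂ (hJ.taylorPoly_eq hA))

lemma continuous_polyC (c : Fin 2 → Fin 2 → Fin 7 → ℝ) (k ℓ : Fin 2) :
    Continuous (polyC c k ℓ) := by
  unfold polyC
  fun_prop

lemma polyC_zero (c : Fin 2 → Fin 2 → Fin 7 → ℝ) (k ℓ : Fin 2) : polyC c k ℓ 0 = c k ℓ 0 := by
  simp [polyC, Fin.sum_univ_succ]

lemma isBigO_polyC_one (c : Fin 2 → Fin 2 → Fin 7 → ℝ) (k ℓ : Fin 2) (hl : l ≤ 𝓝 0) :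
    polyC c k ℓ =O[l] fun _ => (1 : ℝ) :=
  (((continuous_polyC c k ℓ).tendsto 0).mono_left hl).isBigO_one ℝ

theorem cornerScheme_consistent {x₀ y₀ r s : ℝ} (hr : 0 < r) (hs : 0 < s) (hl : l ≤ 𝓝[>] 0)
    {a : ℝ × ℝ → ℝ} {α : ℝ → ℝ} (hc : Coefficients 5 x₀ y₀ r s a α)
    (hsys : SolvesSystem (jet₂ a x₀ y₀) (jet₁ α y₀) c) :
    (cornerScheme (jet₂ a x₀ y₀) (jet₁ α y₀) c).Consistent 5 l x₀ y₀ r s a α 6 := by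
  intro u f g₁ g₃ hsol
  have hA := hc.jet₂_zero_zero_ne hr hs
  have hl₀ : l ≤ 𝓝 0 := hl.trans nhdsWithin_le_nhds
  set A := jet₂ a x₀ y₀
  set al := jet₁ α y₀
  set J := jet₂ u x₀ y₀
  set T := taylorPoly 6 J
  have residual (h : ℝ) :
      (cornerScheme A al c).lhs x₀ y₀ u h - (cornerScheme A al c).rhs x₀ y₀ f g₁ g₃ h =
        ∑ k : Fin 2, ∑ ℓ : Fin 2, polyC c k ℓ h *
          (u (x₀ + (k : ℕ) * h, y₀ + (ℓ : ℕ) * h) - T ((k : ℕ) * h) ((ℓ : ℕ) * h))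
        + ∑ n ∈ ({0, 2, 4, 6} : Finset ℕ), J 0 n * stencilSum c (cornerE A al n) h := by
    have hT := (Solution.formalSolution (k := 5) hr hs hc hsol).stencilSum_taylorPoly hA c h
    simp only [mul_sub, Finset.sum_sub_distrib]
    change _ = _ - stencilSum c T h + _
    rw [hT]
    simp only [FourPointScheme.lhs, FourPointScheme.rhs, cornerScheme]
    ring
  simp_rw [residual]
  refine (IsBigO.fun_sum fun k _ => IsBigO.fun_sum fun ℓ _ => ?_).add
    (IsBigO.fun_sum fun n hn => ((hsys n (by simpa using hn)).mono hl₀).const_mul_left _)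
  have htaylor := (isBigO_sub_taylorPoly (d := 6) hr hs (k : ℕ).cast_nonneg (ℓ : ℕ).cast_nonneg
    hsol.contDiffOn_u).mono hl
  simpa using (isBigO_polyC_one c k ℓ hl₀).mul htaylor

theorem cornerScheme_nondegenerate (hl : l ≤ 𝓝[>] 0) (A : ℕ → ℕ → ℝ) (al : ℕ → ℝ)
    (hc : ∃ k ℓ, c k ℓ 0 ≠ 0) : (cornerScheme A al c).Nondegenerate l := by
  obtain ⟨k, ℓ, hkl⟩ := hc
  refine ⟨|c k ℓ 0| / 2, by positivity, ?_⟩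
  have hlim : Tendsto (fun h => |polyC c k ℓ h|) l (𝓝 |c k ℓ 0|) := by
    rw [← polyC_zero c k ℓ]
    exact ((continuous_polyC c k ℓ).abs.tendsto 0).mono_left (hl.trans nhdsWithin_le_nhds)
  filter_upwards [hlim.eventually (eventually_gt_nhds (half_lt_self (abs_pos.2 hkl)))] with h hh
  exact ⟨k, ℓ, hh.le⟩

end Consistency

section Solvability

open Polynomial

variable {A : ℕ → ℕ → ℝ} {al : ℕ → ℝ} {m n : ℕ}

/-- The jet at the origin of the harmonic polynomial `Re (y + ix)ⁿ / n!`. -/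
def harmonicJet (n m j : ℕ) : ℝ := if m + j = n then (Complex.I ^ m).re else 0

lemma harmonicJet_of_ne {j : ℕ} (h : m + j ≠ n) : harmonicJet n m j = 0 := if_neg h

lemma harmonicJet_of_odd (hm : Odd m) (j : ℕ) : harmonicJet n m j = 0 := by
  obtain ⟨k, rfl⟩ := hm
  have re_zero : (Complex.I ^ (2 * k + 1)).re = 0 := by
    rw [pow_succ, pow_mul, Complex.I_sq, ← Complex.ofReal_one, ← Complex.ofReal_neg,
      ← Complex.ofReal_pow, Complex.re_ofReal_mul, Complex.I_re, mul_zero]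
  rw [harmonicJet, re_zero, ite_self]

lemma harmonicJet_laplace (n m j : ℕ) :
    harmonicJet n (m + 2) j + harmonicJet n m (j + 2) = 0 := by
  simp only [harmonicJet, add_right_comm m 2 j, ← add_assoc m j 2, pow_add, Complex.I_sq, mul_neg,
    mul_one, Complex.neg_re]
  split_ifs <;> ring

/-- The coefficients of the equation and of the Robin condition do not enter, since all derivatives
of order less than `n` vanish. -/
lemma formalSolution_harmonicJet (A : ℕ → ℕ → ℝ) (al : ℕ → ℝ) (hn : Even n) :
    FormalSolution n A al (fun _ _ => 0) (fun _ => 0) (fun _ => 0) (harmonicJet n) where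
  elliptic m j hmj := by
    have lower : lowerJet A (harmonicJet n) m j = lowerJet A 0 m j :=
      lowerJet_congr fun i k hik => harmonicJet_of_ne (by omega)
    rw [divergenceJet_eq_add_lowerJet, harmonicJet_laplace, lower]
    simp [lowerJet]
  robin j hj := by
    rw [harmonicJet_of_odd odd_one, robinJet, sub_zero]
    refine (Finset.sum_eq_zero fun i hi => ?_).symm
    have hi := Finset.mem_range.1 hi
    rw [harmonicJet_of_ne (by omega), mul_zero]
  neumann m _ := by
    rw [neg_zero]
    by_cases hmn : m + 1 = n
    · exact harmonicJet_of_odd (Nat.not_even_iff_odd.1 (Nat.even_add_one.1 (hmn ▸ hn))) 1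
    · exact harmonicJet_of_ne hmn

lemma taylorForm_harmonicJet (n : ℕ) (x y : ℝ) :
    taylorForm (harmonicJet n) n x y = (((y : ℂ) + x * Complex.I) ^ n).re / n.factorial := by
  rw [taylorForm_eq_sum_choose, add_comm, (Commute.all _ _).add_pow', Complex.re_sum,
    div_eq_inv_mul]
  congr 1
  refine Finset.sum_congr rfl fun p hp => ?_
  have factor : n.choose p.1 • ((x * Complex.I) ^ p.1 * (y : ℂ) ^ p.2)
      = ((n.choose p.1 * (x ^ p.1 * y ^ p.2) : ℝ) : ℂ) * Complex.I ^ p.1 := by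
    rw [nsmul_eq_mul]
    push_cast
    ring
  rw [factor, Complex.re_ofReal_mul, harmonicJet,
    if_pos (Finset.HasAntidiagonal.mem_antidiagonal.1 hp)]
  ring

/-- The jet whose Taylor polynomial is `cornerE A al n`. -/
noncomputable def weightJet (A : ℕ → ℕ → ℝ) (al : ℕ → ℝ) (n : ℕ) : ℕ → ℕ → ℝ :=
  cornerJet A al (fun j => if j = n then 1 else 0) (fun _ _ => 0) (fun _ => 0) fun _ => 0

lemma weightJet_eq_harmonicJet (hA : A 0 0 ≠ 0) (al : ℕ → ℝ) (hn : Even n) {j : ℕ}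
    (hmj : m + j ≤ n) : weightJet A al n m j = harmonicJet n m j := by
  refine (isCornerJet_cornerJet n ..).eq
    ((formalSolution_harmonicJet A al hn).isCornerJet hA fun k _ _ => ?_) hmj
  simp [harmonicJet]

/-- The polynomial `h ↦ cornerE A al n (xh) (yh) / hⁿ`. -/
noncomputable def weightPoly (A : ℕ → ℕ → ℝ) (al : ℕ → ℝ) (n : ℕ) (x y : ℝ) : ℝ[X] :=
  ∑ d ∈ Finset.range (7 - n), monomial d (taylorForm (weightJet A al n) (n + d) x y)

lemma cornerE_mul (hA : A 0 0 ≠ 0) (al : ℕ → ℝ) (hn : Even n) (hn₆ : n ≤ 6) (x y h : ℝ) :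
    cornerE A al n (x * h) (y * h) = h ^ n * (weightPoly A al n x y).eval h := by
  have vanish (d : ℕ) (hd : d ∈ Finset.range n) :
      taylorForm (weightJet A al n) d (x * h) (y * h) = 0 := by
    have hd := Finset.mem_range.1 hd
    refine Finset.sum_eq_zero fun p hp => ?_
    have hp := Finset.HasAntidiagonal.mem_antidiagonal.1 hp
    rw [weightJet_eq_harmonicJet hA al hn (by omega), harmonicJet_of_ne (by omega)]
    simp
  calc cornerE A al n (x * h) (y * h)
    _ = ∑ d ∈ Finset.range (n + (7 - n)), taylorForm (weightJet A al n) d (x * h) (y * h) := by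
      rw [cornerE, cornerExpansion_eq_taylorPoly, taylorPoly_eq_sum_taylorForm,
        show n + (7 - n) = 6 + 1 by omega]
      rfl
    _ = ∑ d ∈ Finset.range (7 - n), taylorForm (weightJet A al n) (n + d) (x * h) (y * h) := by
      rw [Finset.sum_range_add, Finset.sum_eq_zero vanish, zero_add]
    _ = h ^ n * (weightPoly A al n x y).eval h := by
      simp only [weightPoly, eval_finsetSum, eval_monomial, taylorForm_mul, Finset.mul_sum]
      exact Finset.sum_congr rfl fun d _ => by ring

lemma eval_zero_weightPoly (hA : A 0 0 ≠ 0) (al : ℕ → ℝ) (hn : Even n) (hn₆ : n ≤ 6) (x y : ℝ) :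
    (weightPoly A al n x y).eval 0 = (((y : ℂ) + x * Complex.I) ^ n).re / n.factorial := by
  rw [← taylorForm_harmonicJet, weightPoly, eval_finsetSum,
    Finset.sum_eq_single_of_mem 0 (Finset.mem_range.2 (by omega))
      fun d _ hd => by simp [eval_monomial, hd]]
  rw [eval_monomial, pow_zero, mul_one, add_zero]
  refine Finset.sum_congr rfl fun p hp => ?_
  rw [weightJet_eq_harmonicJet hA al hn (Finset.HasAntidiagonal.mem_antidiagonal.1 hp).le]

lemma isBigO_eval {p : ℝ[X]} {d : ℕ} (hp : X ^ d ∣ p) :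
    (fun h => p.eval h) =O[𝓝 0] fun h => h ^ d := by
  obtain ⟨q, rfl⟩ := hp
  simp only [eval_mul, eval_pow, eval_X]
  simpa using (isBigO_refl (fun h : ℝ => h ^ d) (𝓝 0)).mul
    ((q.continuous.tendsto 0).isBigO_one ℝ)

lemma isBigO_polyC_coeff_sub (P : Fin 2 → Fin 2 → ℝ[X]) (k ℓ : Fin 2) :
    (fun h => polyC (fun k ℓ i => (P k ℓ).coeff i) k ℓ h - (P k ℓ).eval h) =O[𝓝 0]
      fun h => h ^ 7 := by
  have hdvd : X ^ 7 ∣ ∑ i : Fin 7, monomial (i : ℕ) ((P k ℓ).coeff i) - P k ℓ := by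
    refine X_pow_dvd_iff.2 fun i hi => ?_
    rw [coeff_sub, finsetSum_coeff, Finset.sum_eq_single_of_mem ⟨i, hi⟩ (Finset.mem_univ _)]
    · simp
    · exact fun j _ hj => coeff_monomial_of_ne _ fun h => hj (Fin.ext h.symm)
  simpa [polyC, eval_finsetSum] using isBigO_eval hdvd

lemma solvesSystem_coeff (hA : A 0 0 ≠ 0) {P : Fin 2 → Fin 2 → ℝ[X]}
    (hP : ∀ n ∈ ({0, 2, 4, 6} : Set ℕ), X ^ 7 ∣ X ^ n *
      ∑ k : Fin 2, ∑ ℓ : Fin 2, P k ℓ * weightPoly A al n (k : ℕ) (ℓ : ℕ)) :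
    SolvesSystem A al fun k ℓ i => (P k ℓ).coeff i := by
  intro n hn
  have hn₆ : Even n ∧ n ≤ 6 := by
    rcases hn with rfl | rfl | rfl | rfl <;> decide
  have split : stencilSum (fun k ℓ i => (P k ℓ).coeff i) (cornerE A al n) = fun h =>
      ∑ k : Fin 2, ∑ ℓ : Fin 2, (polyC (fun k ℓ i => (P k ℓ).coeff i) k ℓ h - (P k ℓ).eval h) *
        (X ^ n * weightPoly A al n (k : ℕ) (ℓ : ℕ)).eval h
      + (X ^ n * ∑ k : Fin 2, ∑ ℓ : Fin 2, P k ℓ * weightPoly A al n (k : ℕ) (ℓ : ℕ)).eval h := by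
    ext h
    simp only [stencilSum, cornerE_mul hA al hn₆.1 hn₆.2, eval_mul, eval_pow, eval_X,
      eval_finsetSum, Finset.mul_sum, ← Finset.sum_add_distrib]
    exact Finset.sum_congr rfl fun k _ => Finset.sum_congr rfl fun ℓ _ => by ring
  rw [split]
  refine (IsBigO.fun_sum fun k _ => IsBigO.fun_sum fun ℓ _ => ?_).add (isBigO_eval (hP n hn))
  exact ((isBigO_polyC_coeff_sub P k ℓ).mul
    (((X ^ n * weightPoly A al n (k : ℕ) (ℓ : ℕ)).continuous.tendsto 0).isBigO_one ℝ)).congr_right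
      fun h => mul_one _

lemma exists_dvd_mulVec_sub {R ι : Type*} [CommRing R] [Fintype ι] [DecidableEq ι]
    (M : Matrix ι ι R) (b : ι → R) {r : R} (h : IsCoprime M.det r) :
    ∃ v, ∀ i, r ∣ (M.mulVec v - b) i := by
  obtain ⟨c, d, hcd⟩ := h
  refine ⟨c • M.adjugate.mulVec b, fun i => ⟨-d * b i, ?_⟩⟩
  rw [Matrix.mulVec_smul, Matrix.mulVec_mulVec, Matrix.mul_adjugate, Matrix.smul_mulVec,
    Matrix.one_mulVec]
  simp only [Pi.sub_apply, Pi.smul_apply, smul_eq_mul]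
  linear_combination b i * hcd

lemma eval_zero_weightPoly_zero (hA : A 0 0 ≠ 0) (al : ℕ → ℝ) (x y : ℝ) :
    (weightPoly A al 0 x y).eval 0 = 1 := by
  simp [eval_zero_weightPoly hA]

lemma eval_zero_weightPoly_two (hA : A 0 0 ≠ 0) (al : ℕ → ℝ) (x y : ℝ) :
    (weightPoly A al 2 x y).eval 0 = (y ^ 2 - x ^ 2) / 2 := by
  rw [eval_zero_weightPoly hA al (by decide) (by decide)]
  simp [pow_succ, Nat.factorial]

lemma eval_zero_weightPoly_four (hA : A 0 0 ≠ 0) (al : ℕ → ℝ) (x y : ℝ) :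
    (weightPoly A al 4 x y).eval 0 = (y ^ 4 - 6 * x ^ 2 * y ^ 2 + x ^ 4) / 24 := by
  rw [eval_zero_weightPoly hA al (by decide) (by decide)]
  simp only [pow_succ, pow_zero, one_mul, Complex.mul_re, Complex.mul_im, Complex.add_re,
    Complex.add_im, Complex.ofReal_re, Complex.ofReal_im, Complex.I_re, Complex.I_im, Nat.factorial]
  push_cast
  ring

lemma eval_zero_weightPoly_six (hA : A 0 0 ≠ 0) (al : ℕ → ℝ) (x y : ℝ) :
    (weightPoly A al 6 x y).eval 0
      = (y ^ 6 - 15 * x ^ 2 * y ^ 4 + 15 * x ^ 4 * y ^ 2 - x ^ 6) / 720 := by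
  rw [eval_zero_weightPoly hA al (by decide) (by decide)]
  simp only [pow_succ, pow_zero, one_mul, Complex.mul_re, Complex.mul_im, Complex.add_re,
    Complex.add_im, Complex.ofReal_re, Complex.ofReal_im, Complex.I_re, Complex.I_im, Nat.factorial]
  push_cast
  ring

lemma exists_dvd_sum_weightPoly (hA : A 0 0 ≠ 0) (al : ℕ → ℝ) :
    ∃ v : Fin 3 → ℝ[X], ∀ i : Fin 3, X ^ 7 ∣ v 0 * weightPoly A al (2 * i) 0 0
      + v 1 * weightPoly A al (2 * i) 0 1 + v 2 * weightPoly A al (2 * i) 1 0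
      + weightPoly A al (2 * i) 1 1 := by
  let M : Matrix (Fin 3) (Fin 3) ℝ[X] := Matrix.of fun i =>
    ![weightPoly A al (2 * i) 0 0, weightPoly A al (2 * i) 0 1, weightPoly A al (2 * i) 1 0]
  have det_lead : M.det.eval 0 = 1 / 24 := by
    simp only [Matrix.det_fin_three, Matrix.of_apply, Matrix.cons_val, Fin.coe_ofNat_eq_mod,
      Nat.reduceMod, Nat.reduceMul, eval_sub, eval_add, eval_mul, eval_zero_weightPoly_zero hA,
      eval_zero_weightPoly_two hA, eval_zero_weightPoly_four hA, M]
    norm_num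
  have hcop : IsCoprime M.det (X ^ 7) := by
    refine (IsCoprime.symm <| irreducible_X.coprime_iff_not_dvd.2 fun h => ?_).pow_right
    rw [X_dvd_iff, coeff_zero_eq_eval_zero, det_lead] at h
    norm_num at h
  obtain ⟨v, hv⟩ := exists_dvd_mulVec_sub M (fun i => -weightPoly A al (2 * i) 1 1) hcop
  refine ⟨v, fun i => ?_⟩
  convert hv i using 1
  simp only [Matrix.mulVec, dotProduct, Fin.sum_univ_three, Pi.sub_apply, Matrix.of_apply,
    Matrix.cons_val, M]
  ring

theorem exists_solvesSystem (hA : A 0 0 ≠ 0) (al : ℕ → ℝ) :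
    ∃ c : Fin 2 → Fin 2 → Fin 7 → ℝ, c 1 1 0 = 1 ∧ SolvesSystem A al c := by
  obtain ⟨v, row⟩ := exists_dvd_sum_weightPoly hA al
  let L (n : ℕ) : ℝ[X] := v 0 * weightPoly A al n 0 0 + v 1 * weightPoly A al n 0 1
    + v 2 * weightPoly A al n 1 0 + weightPoly A al n 1 1
  -- At `h = 0` the row `n = 6` is a multiple of the row `n = 2`.
  have row₆ : X ∣ L 6 := by
    have lead₂ := X_dvd_iff.1 ((dvd_pow_self X (by norm_num)).trans (row 1))
    rw [coeff_zero_eq_eval_zero] at lead₂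
    rw [X_dvd_iff, coeff_zero_eq_eval_zero]
    simp only [eval_add, eval_mul, Fin.coe_ofNat_eq_mod, Nat.reduceMod, mul_one,
      eval_zero_weightPoly_two hA, eval_zero_weightPoly_six hA, L] at lead₂ ⊢
    linarith
  refine ⟨fun k ℓ i => (![![v 0, v 1], ![v 2, 1]] k ℓ).coeff i, by simp,
    solvesSystem_coeff hA fun n hn => ?_⟩
  suffices X ^ 7 ∣ X ^ n * L n by
    simpa only [Fin.sum_univ_two, Fin.val_zero, Fin.val_one, Nat.cast_zero, Nat.cast_one,
      Matrix.cons_val, one_mul, ← add_assoc] using this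
  rcases hn with rfl | rfl | rfl | rfl
  · exact (row 0).mul_left _
  · exact (row 1).mul_left _
  · exact (row 2).mul_left _
  · exact pow_succ (X : ℝ[X]) 6 ▸ mul_dvd_mul_left _ row₆

end Solvability

noncomputable section OrderBarrier

open Complex (I)

variable {x₀ y₀ r s a₀ α : ℝ} {l : Filter ℝ} {p : ℕ}

/-- The complex coordinate `(y - y₀) + (x - x₀) i` centred at the corner; its real axis is the
side on `Γ₁` and its imaginary axis the side on `Γ₃`. -/
def cornerCoord (x₀ y₀ x y : ℝ) : ℂ := (y - y₀ : ℝ) + (x - x₀ : ℝ) * I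

lemma contDiff_cornerCoord {n : WithTop ℕ∞} :
    ContDiff ℝ n fun z : ℝ × ℝ => cornerCoord x₀ y₀ z.1 z.2 :=
  (Complex.ofRealCLM.contDiff.comp (contDiff_snd.sub contDiff_const)).add
    ((Complex.ofRealCLM.contDiff.comp (contDiff_fst.sub contDiff_const)).mul contDiff_const)

lemma hasDerivAt_comp_cornerCoord_fst {G : ℂ → ℂ} (hG : Differentiable ℂ G) (x₀ y₀ x y : ℝ) :
    HasDerivAt (fun x => G (cornerCoord x₀ y₀ x y)) (I * deriv G (cornerCoord x₀ y₀ x y)) x := by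
  have hcoord : HasDerivAt (fun x => cornerCoord x₀ y₀ x y) I x := by
    simpa [cornerCoord] using (((hasDerivAt_id x).sub_const x₀).ofReal_comp.mul_const I).const_add
      ((y - y₀ : ℝ) : ℂ)
  exact (hG _).hasDerivAt.scomp x hcoord

lemma hasDerivAt_comp_cornerCoord_snd {G : ℂ → ℂ} (hG : Differentiable ℂ G) (x₀ y₀ x y : ℝ) :
    HasDerivAt (fun y => G (cornerCoord x₀ y₀ x y)) (deriv G (cornerCoord x₀ y₀ x y)) y := by
  have hcoord : HasDerivAt (fun y => cornerCoord x₀ y₀ x y) 1 y := by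
    simpa [cornerCoord] using
      ((hasDerivAt_id y).sub_const y₀).ofReal_comp.add_const ((x - x₀ : ℝ) * I)
  simpa [Function.comp_def] using (hG _).hasDerivAt.scomp y hcoord

lemma hasDerivAt_re {g : ℝ → ℂ} {g' : ℂ} {t : ℝ} (hg : HasDerivAt g g' t) :
    HasDerivAt (fun t => (g t).re) g'.re t :=
  Complex.reCLM.hasFDerivAt.comp_hasDerivAt t hg

lemma solution_re_of_differentiable {G : ℂ → ℂ} (hG : Differentiable ℂ G)
    (hrobin : ∀ y : ℝ, (deriv G y).im + α * (G y).re = 0)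
    (hneumann : ∀ x : ℝ, (deriv G (x * I)).re = 0) :
    Solution ⊤ x₀ y₀ r s (fun _ => a₀) (fun _ => α)
      (fun z => (G (cornerCoord x₀ y₀ z.1 z.2)).re) 0 0 0 where
  contDiffOn_u := (Complex.reCLM.contDiff.comp
    ((hG.contDiff.restrict_scalars ℝ).comp contDiff_cornerCoord)).contDiffOn
  contDiffOn_f := contDiffOn_const
  contDiffOn_g₁ := contDiffOn_const
  contDiffOn_g₃ := contDiffOn_const
  pde x _ y _ := by
    have hG' : Differentiable ℂ (deriv G) := hG.deriv
    have hx (t : ℝ) := (hasDerivAt_re (hasDerivAt_comp_cornerCoord_fst hG x₀ y₀ t y)).deriv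
    have hy (t : ℝ) := (hasDerivAt_re (hasDerivAt_comp_cornerCoord_snd hG x₀ y₀ x t)).deriv
    have hxx := hasDerivAt_re ((hasDerivAt_comp_cornerCoord_fst hG' x₀ y₀ x y).const_mul I)
    have hyy := hasDerivAt_re (hasDerivAt_comp_cornerCoord_snd hG' x₀ y₀ x y)
    simp only [hx, hy, (hxx.const_mul a₀).deriv, (hyy.const_mul a₀).deriv, ← mul_assoc,
      Complex.I_mul_I, neg_one_mul, Complex.neg_re, Pi.zero_apply]
    ring
  robin y _ := by
    have hx := (hasDerivAt_re (hasDerivAt_comp_cornerCoord_fst hG x₀ y₀ x₀ y)).hasDerivWithinAt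
      (s := Ici x₀)
    simp only [hx.derivWithin (uniqueDiffOn_Ici x₀ x₀ self_mem_Ici)]
    simpa [cornerCoord] using hrobin (y - y₀)
  neumann x _ := by
    have hy := (hasDerivAt_re (hasDerivAt_comp_cornerCoord_snd hG x₀ y₀ x y₀)).hasDerivWithinAt
      (s := Ici y₀)
    simp only [hy.derivWithin (uniqueDiffOn_Ici y₀ y₀ self_mem_Ici)]
    simpa [cornerCoord] using hneumann (x - x₀)

/-- The entire function `zⁿ / n! - i α zⁿ⁺¹ / (n + 1)!`, whose real part is harmonic with leading
part of degree `n` and, for even `n`, satisfies both homogeneous boundary conditions. -/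
def robinPower (α : ℝ) (n : ℕ) (z : ℂ) : ℂ :=
  z ^ n / n.factorial - I * α * z ^ (n + 1) / (n + 1).factorial

lemma differentiable_robinPower (n : ℕ) : Differentiable ℂ (robinPower α n) := by
  unfold robinPower
  fun_prop

lemma deriv_robinPower (n : ℕ) (z : ℂ) :
    deriv (robinPower α n) z = n * z ^ (n - 1) / n.factorial - I * α * z ^ n / n.factorial := by
  have h : HasDerivAt (robinPower α n) _ z := ((hasDerivAt_pow n z).div_const _).sub
    (((hasDerivAt_pow (n + 1) z).const_mul (I * α)).div_const _)
  have hn : (n + 1 : ℂ) ≠ 0 := Nat.cast_add_one_ne_zero n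
  have hfac : (n.factorial : ℂ) ≠ 0 := Nat.cast_ne_zero.2 n.factorial_ne_zero
  rw [h.deriv, Nat.factorial_succ, Nat.add_sub_cancel]
  push_cast
  field_simp

lemma im_deriv_robinPower_add (n : ℕ) (y : ℝ) :
    (deriv (robinPower α n) y).im + α * (robinPower α n y).re = 0 := by
  simp only [deriv_robinPower, robinPower]
  norm_cast
  simp only [Complex.sub_im, Complex.sub_re, Complex.div_natCast_im, Complex.div_natCast_re,
    Complex.mul_im, Complex.mul_re, Complex.ofReal_im, Complex.ofReal_re, Complex.I_im,
    Complex.I_re]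
  ring

lemma re_deriv_robinPower_mul_I {n : ℕ} (hn : Even n) (x : ℝ) :
    (deriv (robinPower α n) (x * I)).re = 0 := by
  obtain ⟨k, rfl⟩ := hn.two_dvd
  have hsq : ((x : ℂ) * I) ^ 2 = ((-x ^ 2 : ℝ) : ℂ) := by simp [mul_pow]
  rw [deriv_robinPower, pow_mul, hsq]
  cases k with
  | zero => simp
  | succ k =>
    rw [show 2 * (k + 1) - 1 = 2 * k + 1 by lia, pow_succ, pow_mul, hsq]
    norm_cast
    simp [-Complex.ofReal_pow, -Complex.ofReal_neg]

lemma tendsto_zero_of_isBigO_mul_one_add_norm {E : Type*} [NormedAddCommGroup E] {v : ℝ → E}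
    (hl : l ≤ 𝓝 0) (hv : v =O[l] fun h => h * (1 + ‖v h‖)) : Tendsto v l (𝓝 0) := by
  have hid : (fun h : ℝ => h) =o[l] fun _ => (1 : ℝ) := (isLittleO_one_iff ℝ).2 hl
  have hsmall : (fun h => ‖v h‖) =o[l] fun h => 1 + ‖v h‖ := by
    simpa using hv.norm_left.trans_isLittleO (hid.mul_isBigO (isBigO_refl (fun h => 1 + ‖v h‖) l))
  have hbounded : (fun h => 1 + ‖v h‖) =O[l] fun _ => (1 : ℝ) := by
    simpa using hsmall.right_isBigO_sub
  exact (hv.trans ((isBigO_refl _ l).mul hbounded)).trans_tendsto (by simpa using! hl)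

lemma rhs_zero (S : FourPointScheme) (x₀ y₀ h : ℝ) : S.rhs x₀ y₀ 0 0 0 h = 0 := by
  simp [FourPointScheme.rhs, jet₁, jet₂]

/-- The value at the grid point `(k, ℓ)` of the solution with leading part `Re (y + ix)ⁿ / n!` of
the homogeneous problem, divided by `hⁿ`. -/
def gridValue (α : ℝ) (n k ℓ : ℕ) (h : ℝ) : ℝ :=
  ((ℓ + k * I : ℂ) ^ n).re / n.factorial
    + α * h * ((ℓ + k * I : ℂ) ^ (n + 1)).im / (n + 1).factorial

lemma re_robinPower_cornerCoord (n k ℓ : ℕ) (h : ℝ) :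
    (robinPower α n (cornerCoord x₀ y₀ (x₀ + k * h) (y₀ + ℓ * h))).re =
      h ^ n * gridValue α n k ℓ h := by
  have hgrid : cornerCoord x₀ y₀ (x₀ + k * h) (y₀ + ℓ * h) = h * (ℓ + k * I) := by
    simp only [cornerCoord, add_sub_cancel_left]
    push_cast
    ring
  rw [robinPower, hgrid, mul_pow, mul_pow, gridValue]
  simp only [Complex.sub_re, Complex.div_natCast_re, mul_assoc, Complex.I_mul_re,
    Complex.im_ofReal_mul, Complex.re_ofReal_mul, ← Complex.ofReal_pow]
  ring

lemma isBigO_pow_of_le {m n : ℕ} (hl : l ≤ 𝓝 0) (hmn : m ≤ n) :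
    (fun h : ℝ => h ^ n) =O[l] fun h => h ^ m := by
  rcases hmn.eq_or_lt with rfl | hlt
  · exact isBigO_refl _ _
  · exact ((isLittleO_pow_pow hlt).mono hl).isBigO

lemma isBigO_of_pow_mul {f : ℝ → ℝ} {m n : ℕ} (hl : l ≤ 𝓝[≠] 0)
    (h : (fun h => h ^ n * f h) =O[l] fun h => h ^ (m + n)) : f =O[l] fun h => h ^ m := by
  have hne : ∀ᶠ h in l, h ≠ 0 := hl self_mem_nhdsWithin
  refine ((isBigO_refl (fun h : ℝ => (h ^ n)⁻¹) l).mul h).congr' ?_ ?_ <;>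
    filter_upwards [hne] with h hh <;> field_simp
  ring

lemma isBigO_sum_gridValue {S : FourPointScheme} (hl : l ≤ 𝓝[>] 0)
    (hS : S.Consistent ⊤ l x₀ y₀ r s (fun _ => a₀) (fun _ => α) p) {n : ℕ} (hn : Even n)
    {m : ℕ} (hm : m + n ≤ p + 1) :
    (fun h => ∑ k : Fin 2, ∑ ℓ : Fin 2, S.C k ℓ h * gridValue α n k ℓ h) =O[l]
      fun h => h ^ m := by
  have hres := hS _ _ _ _ (solution_re_of_differentiable (differentiable_robinPower n)
    (im_deriv_robinPower_add n) (re_deriv_robinPower_mul_I hn))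
  have hpow : (fun h : ℝ => h ^ (p + 1)) =O[l] fun h => h ^ (m + n) :=
    isBigO_pow_of_le (hl.trans nhdsWithin_le_nhds) hm
  refine isBigO_of_pow_mul (hl.trans (nhdsWithin_mono _ fun _ h => (mem_Ioi.1 h).ne'))
    ((hres.trans hpow).congr_left fun h => ?_)
  simp only [rhs_zero, sub_zero, FourPointScheme.lhs, re_robinPower_cornerCoord, Finset.mul_sum]
  exact Finset.sum_congr rfl fun k _ => Finset.sum_congr rfl fun ℓ _ => mul_left_comm _ _ _

lemma gridValue_corner {n : ℕ} (hn : n ≠ 0) (h : ℝ) : gridValue α n 0 0 h = 0 := by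
  simp [gridValue, hn]

lemma gridValue_zero_one (n : ℕ) (h : ℝ) : gridValue α n 0 1 h = 1 / n.factorial := by
  simp [gridValue]

lemma gridValue_one_zero (j : ℕ) (h : ℝ) :
    gridValue α (2 * j) 1 0 h =
      (-1) ^ j * (1 / (2 * j).factorial + α * h / (2 * j + 1).factorial) := by
  have hI : I ^ (2 * j) = ((-1 : ℝ) ^ j : ℝ) := by simp [pow_mul]
  simp only [gridValue, Nat.cast_zero, Nat.cast_one, one_mul, zero_add, pow_succ, hI,
    Complex.ofReal_re, Complex.mul_im, Complex.I_im, Complex.ofReal_im, Complex.I_re]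
  ring

lemma gridValue_one_one (j : ℕ) (h : ℝ) :
    gridValue α (2 * j) 1 1 h = ((2 * I) ^ j).re / (2 * j).factorial
      + α * h * (((2 * I) ^ j).re + ((2 * I) ^ j).im) / (2 * j + 1).factorial := by
  have hsq : (1 + I) ^ 2 = 2 * I := by rw [add_sq, Complex.I_sq]; ring
  simp [gridValue, pow_succ _ (2 * j), pow_mul, hsq]

lemma sum_gridValue_zero (c : Fin 2 → Fin 2 → ℝ) (h : ℝ) :
    ∑ k : Fin 2, ∑ ℓ : Fin 2, c k ℓ * gridValue α 0 k ℓ h =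
      c 0 0 + c 0 1 + c 1 0 * (1 + α * h) + c 1 1 * (1 + α * h) := by
  have hvalue (k ℓ : ℕ) : gridValue α 0 k ℓ h = 1 + α * h * k := by simp [gridValue]
  simp only [Fin.sum_univ_two, hvalue, Fin.val_zero, Fin.val_one, Nat.cast_zero, Nat.cast_one]
  ring

lemma sum_gridValue {n : ℕ} (hn : n ≠ 0) (c : Fin 2 → Fin 2 → ℝ) (h : ℝ) :
    ∑ k : Fin 2, ∑ ℓ : Fin 2, c k ℓ * gridValue α n k ℓ h =
      c 0 1 / n.factorial + c 1 0 * gridValue α n 1 0 h + c 1 1 * gridValue α n 1 1 h := by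
  simp [Fin.sum_univ_two, gridValue_corner hn, gridValue_zero_one, add_assoc, div_eq_mul_inv]

lemma sum_gridValue_two (c : Fin 2 → Fin 2 → ℝ) (h : ℝ) :
    ∑ k : Fin 2, ∑ ℓ : Fin 2, c k ℓ * gridValue α 2 k ℓ h =
      c 0 1 / 2 - c 1 0 * (1 / 2 + α * h / 6) + c 1 1 * (α * h / 3) := by
  have h₁₀ : gridValue α 2 1 0 h = -(1 / 2 + α * h / 6) :=
    (gridValue_one_zero 1 h).trans (by norm_num [Nat.factorial])
  have h₁₁ : gridValue α 2 1 1 h = α * h / 3 :=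
    (gridValue_one_one 1 h).trans (by norm_num [Nat.factorial]; ring)
  have hfac : Nat.factorial 2 = 2 := rfl
  rw [sum_gridValue (by norm_num), h₁₀, h₁₁, hfac]
  push_cast
  ring

lemma sum_gridValue_four (c : Fin 2 → Fin 2 → ℝ) (h : ℝ) :
    ∑ k : Fin 2, ∑ ℓ : Fin 2, c k ℓ * gridValue α 4 k ℓ h =
      c 0 1 / 24 + c 1 0 * (1 / 24 + α * h / 120) - c 1 1 * (1 / 6 + α * h / 30) := by
  have h₁₀ : gridValue α 4 1 0 h = 1 / 24 + α * h / 120 :=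
    (gridValue_one_zero 2 h).trans (by norm_num [Nat.factorial])
  have h₁₁ : gridValue α 4 1 1 h = -(1 / 6 + α * h / 30) :=
    (gridValue_one_one 2 h).trans (by norm_num [Nat.factorial, pow_succ]; ring)
  have hfac : Nat.factorial 4 = 24 := rfl
  rw [sum_gridValue (by norm_num), h₁₀, h₁₁, hfac]
  push_cast
  ring

lemma sum_gridValue_six (c : Fin 2 → Fin 2 → ℝ) (h : ℝ) :
    ∑ k : Fin 2, ∑ ℓ : Fin 2, c k ℓ * gridValue α 6 k ℓ h =
      c 0 1 / 720 - c 1 0 * (1 / 720 + α * h / 5040) - c 1 1 * (α * h / 630) := by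
  have h₁₀ : gridValue α 6 1 0 h = -(1 / 720 + α * h / 5040) :=
    (gridValue_one_zero 3 h).trans (by norm_num [Nat.factorial])
  have h₁₁ : gridValue α 6 1 1 h = -(α * h / 630) :=
    (gridValue_one_one 3 h).trans (by norm_num [Nat.factorial, pow_succ]; ring)
  have hfac : Nat.factorial 6 = 720 := rfl
  rw [sum_gridValue (by norm_num), h₁₀, h₁₁, hfac]
  push_cast
  ring

lemma isBigO_of_moments {v : ℝ → Fin 2 → Fin 2 → ℝ} {b : ℝ → ℝ}
    (hsum : (fun h => v h 0 0 + v h 0 1 + v h 1 0 + v h 1 1) =O[l] b)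
    (htwo : (fun h => v h 0 1 - v h 1 0) =O[l] b)
    (hfour : (fun h => v h 0 1 + v h 1 0 - 4 * v h 1 1) =O[l] b)
    (hsix : (fun h => 2 * v h 1 0 - 19 * v h 1 1) =O[l] b) : v =O[l] b := by
  have h₁₁ : (fun h => v h 1 1) =O[l] b :=
    (((hfour.sub htwo).sub hsix).const_mul_left (1 / 15)).congr_left fun h => by ring
  have h₁₀ : (fun h => v h 1 0) =O[l] b :=
    ((hsix.add (h₁₁.const_mul_left 19)).const_mul_left (1 / 2)).congr_left fun h => by ring
  have h₀₁ : (fun h => v h 0 1) =O[l] b := (htwo.add h₁₀).congr_left fun h => by ring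
  have h₀₀ : (fun h => v h 0 0) =O[l] b :=
    (((hsum.sub h₀₁).sub h₁₀).sub h₁₁).congr_left fun h => by ring
  refine isBigO_pi.2 fun k => isBigO_pi.2 fun ℓ => ?_
  fin_cases k <;> fin_cases ℓ <;> assumption

/-- The leading parts of degrees 2 and 6 are proportional on the stencil, so that eliminating them
leaves a relation between the terms with the factor `α h`. -/
lemma isBigO_of_eliminate_two_six {v : ℝ → Fin 2 → Fin 2 → ℝ} (hα : α ≠ 0) (hl : l ≤ 𝓝[>] 0)
    (h₂ : (fun h => v h 0 1 / 2 - v h 1 0 * (1 / 2 + α * h / 6) + v h 1 1 * (α * h / 3)) =O[l]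
      fun h => h ^ 6)
    (h₆ : (fun h => v h 0 1 / 720 - v h 1 0 * (1 / 720 + α * h / 5040)
      - v h 1 1 * (α * h / 630)) =O[l] fun h => h ^ 2) :
    (fun h => 2 * v h 1 0 - 19 * v h 1 1) =O[l] fun h => h ^ 1 := by
  refine isBigO_of_pow_mul (n := 1) (hl.trans (nhdsWithin_mono _ fun _ h => (mem_Ioi.1 h).ne')) ?_
  have h₂' := h₂.trans (isBigO_pow_of_le (m := 2) (hl.trans nhdsWithin_le_nhds) (by norm_num))
  refine (((h₆.const_mul_left 720).sub (h₂'.const_mul_left 2)).const_mul_left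
    (21 / (2 * α))).congr_left fun h => ?_
  field_simp
  ring

lemma isBigO_of_sum_gridValue {v : ℝ → Fin 2 → Fin 2 → ℝ} (hα : α ≠ 0) (hl : l ≤ 𝓝[>] 0)
    (hv : ∀ n, Even n → n ≤ 6 →
      (fun h => ∑ k : Fin 2, ∑ ℓ : Fin 2, v h k ℓ * gridValue α n k ℓ h) =O[l]
        fun h => h ^ (8 - n)) :
    v =O[l] fun h => h * (1 + ‖v h‖) := by
  have hl₀ : l ≤ 𝓝 0 := hl.trans nhdsWithin_le_nhds
  have hentry (k ℓ : Fin 2) : (fun h => h * v h k ℓ) =O[l] fun h => h * (1 + ‖v h‖) := by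
    refine (isBigO_refl _ l).mul (IsBigO.of_norm_le fun h => ?_)
    exact (norm_le_pi_norm (v h k) ℓ).trans ((norm_le_pi_norm (v h) k).trans
      (le_add_of_nonneg_left zero_le_one))
  have hpow {f : ℝ → ℝ} (n : ℕ) (hf : f =O[l] fun h => h ^ (n + 1)) :
      f =O[l] fun h => h * (1 + ‖v h‖) := by
    have hone : (fun _ : ℝ => (1 : ℝ)) =O[l] fun h => 1 + ‖v h‖ :=
      IsBigO.of_norm_le fun h => by simp
    simpa using (hf.trans (isBigO_pow_of_le hl₀ (Nat.le_add_left 1 n))).trans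
      (by simpa using (isBigO_refl (fun h : ℝ => h) l).mul hone)
  have h₀ := hpow 7 (hv 0 (by decide) (by lia))
  have h₂ := hv 2 (by decide) (by lia)
  have h₄ := hpow 3 (hv 4 (by decide) (by lia))
  have h₆ := hv 6 (by decide) le_rfl
  simp only [sum_gridValue_zero, sum_gridValue_two, sum_gridValue_four, sum_gridValue_six]
    at h₀ h₂ h₄ h₆
  have hsum : (fun h => v h 0 0 + v h 0 1 + v h 1 0 + v h 1 1) =O[l] fun h => h * (1 + ‖v h‖) :=
    ((h₀.sub ((hentry 1 0).const_mul_left α)).sub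
      ((hentry 1 1).const_mul_left α)).congr_left fun h => by ring
  have htwo : (fun h => v h 0 1 - v h 1 0) =O[l] fun h => h * (1 + ‖v h‖) :=
    ((((hpow 5 h₂).const_mul_left 2).add ((hentry 1 0).const_mul_left (α / 3))).sub
      ((hentry 1 1).const_mul_left (2 * α / 3))).congr_left fun h => by ring
  have hfour : (fun h => v h 0 1 + v h 1 0 - 4 * v h 1 1) =O[l] fun h => h * (1 + ‖v h‖) :=
    (((h₄.const_mul_left 24).sub ((hentry 1 0).const_mul_left (α / 5))).add
      ((hentry 1 1).const_mul_left (4 * α / 5))).congr_left fun h => by ring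
  exact isBigO_of_moments hsum htwo hfour (hpow 0 (isBigO_of_eliminate_two_six hα hl h₂ h₆))

theorem le_six_of_attainsOrder [l.NeBot] (hl : l ≤ 𝓝[>] 0) (hα : α ≠ 0)
    (h : AttainsOrder l x₀ y₀ r s (fun _ => a₀) (fun _ => α) p) : p ≤ 6 := by
  by_contra! hp
  obtain ⟨S, ⟨δ, hδ, hnondeg⟩, hS⟩ := h
  have hsmall : Tendsto (fun h k ℓ => S.C k ℓ h) l (𝓝 0) :=
    tendsto_zero_of_isBigO_mul_one_add_norm (hl.trans nhdsWithin_le_nhds)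
      (isBigO_of_sum_gridValue hα hl fun n hn hn₆ => isBigO_sum_gridValue hl hS hn (by lia))
  obtain ⟨h, ⟨k, ℓ, hδC⟩, hCδ⟩ :=
    (hnondeg.and (hsmall.norm.eventually_lt_const (by simpa using hδ))).exists
  exact (hδC.trans ((norm_le_pi_norm (fun ℓ => S.C k ℓ h) ℓ).trans
    (norm_le_pi_norm (fun k ℓ => S.C k ℓ h) k))).not_gt hCδ

end OrderBarrier

theorem attainsOrder_six {x₀ y₀ r s : ℝ} (hr : 0 < r) (hs : 0 < s) {l : Filter ℝ}
    (hl : l ≤ 𝓝[>] 0) {a : ℝ × ℝ → ℝ} {α : ℝ → ℝ} (hc : Coefficients ⊤ x₀ y₀ r s a α) :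
    AttainsOrder l x₀ y₀ r s a α 6 := by
  obtain ⟨c, hc₁, hsys⟩ := exists_solvesSystem (hc.jet₂_zero_zero_ne hr hs) (jet₁ α y₀)
  exact ⟨cornerScheme (jet₂ a x₀ y₀) (jet₁ α y₀) c,
    cornerScheme_nondegenerate hl _ _ ⟨1, 1, by rw [hc₁]; exact one_ne_zero⟩,
    fun u f g₁ g₃ hu => cornerScheme_consistent hr hs hl (hc.mono le_top) hsys u f g₁ g₃
      (hu.mono le_top)⟩

lemma coefficients_const (x₀ y₀ r s : ℝ) {a₀ : ℝ} (ha : 0 < a₀) (α₀ : ℝ) :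
    Coefficients ⊤ x₀ y₀ r s (fun _ => a₀) (fun _ => α₀) :=
  ⟨contDiffOn_const, contDiffOn_const, fun _ _ => ha⟩

end CornerFD

theorem theorem2p5 (x₀ y₀ r s : ℝ) (hr : 0 < r) (hs : 0 < s)
    (l : Filter ℝ) [l.NeBot] (hl : l ≤ 𝓝[>] 0) :
    -- the constructed scheme exists and is of order six
    (∀ (a : ℝ × ℝ → ℝ) (α : ℝ → ℝ), CornerFD.Coefficients 5 x₀ y₀ r s a α →
      (∃ c : Fin 2 → Fin 2 → Fin 7 → ℝ, c 1 1 0 = 1 ∧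
        CornerFD.SolvesSystem (CornerFD.jet₂ a x₀ y₀) (CornerFD.jet₁ α y₀) c) ∧
      ∀ c : Fin 2 → Fin 2 → Fin 7 → ℝ,
        CornerFD.SolvesSystem (CornerFD.jet₂ a x₀ y₀) (CornerFD.jet₁ α y₀) c →
        (CornerFD.cornerScheme (CornerFD.jet₂ a x₀ y₀) (CornerFD.jet₁ α y₀) c).Consistent
            5 l x₀ y₀ r s a α 6 ∧
        ((∃ k ℓ, c k ℓ 0 ≠ 0) →
          (CornerFD.cornerScheme (CornerFD.jet₂ a x₀ y₀) (CornerFD.jet₁ α y₀) c).Nondegenerate l)) ∧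
    -- six is the largest order available for all smooth `a` and `α`
    IsGreatest {p : ℕ | ∀ (a : ℝ × ℝ → ℝ) (α : ℝ → ℝ), CornerFD.Coefficients ⊤ x₀ y₀ r s a α →
      CornerFD.AttainsOrder l x₀ y₀ r s a α p} 6 ∧
    -- and already for each constant `a > 0` and each constant `α ≠ 0`
    (∀ a₀ α₀ : ℝ, 0 < a₀ → α₀ ≠ 0 →
      IsGreatest {p : ℕ | CornerFD.AttainsOrder l x₀ y₀ r s (fun _ => a₀) (fun _ => α₀) p} 6) := by
  refine ⟨fun a α hc => ⟨CornerFD.exists_solvesSystem (hc.jet₂_zero_zero_ne hr hs) _,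
      fun c hsys => ⟨CornerFD.cornerScheme_consistent hr hs hl hc hsys,
        CornerFD.cornerScheme_nondegenerate hl _ _⟩⟩,
    ⟨fun a α hc => CornerFD.attainsOrder_six hr hs hl hc, fun p hp => ?_⟩,
    fun a₀ α₀ ha hα => ⟨?_, fun p hp => CornerFD.le_six_of_attainsOrder hl hα hp⟩⟩
  · exact CornerFD.le_six_of_attainsOrder hl one_ne_zero
      (hp _ _ (CornerFD.coefficients_const x₀ y₀ r s one_pos 1))
  · exact CornerFD.attainsOrder_six hr hs hl (CornerFD.coefficients_const x₀ y₀ r s ha α₀)
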